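/- **Setting.** Let $P\subset\mathbb{R}^d$ be a lattice $d$-polytope, i.e. a full-dimensional convex hull of finitely many points of $\mathbb{Z}^d$; let $\partial P$ be the union of its facets, $\mathcal{A}=P\cap\mathbb{Z}^d$, $\mathcal{B}=\partial P\cap\mathbb{Z}^d$, let $\mathbb{K}$ be a field and $R_P=\mathbb{K}[x_\alpha:\alpha\in\mathcal{A}]$. *The toric boundary ideal.* Let $\operatorname{cone}(P)\subset\mathbb{R}^{d+1}$ be the cone over $P\times\{1\}$, $S_P=\operatorname{cone}(P)\cap\mathbb{Z}^{d+1}$, $S_P^\circ=\operatorname{cone}(P)^\circ\cap\mathbb{Z}^{d+1}$, $\mathbb{K}[P]=\mathbb{K}[S_P]$, and let $\varphi_P:R_P\to\mathbb{K}[P]$, $x_\alpha\mapsto t^{(\alpha,1)}$. Put $J_{P^\circ}=\langle t^u: u\in S_P^\circ\rangle\subseteq\mathbb{K}[P]$, $I_{\partial P}=\varphi_P^{-1}(J_{P^\circ})$, $I_P=\ker\varphi_P$ and $M_P=\langle x^c:\sum_\alpha c_\alpha(\alpha,1)\in S_P^\circ\rangle$. *Regular subdivisions.* For a polytope $Q$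 and weights $w:Q\cap\mathbb{Z}^d\to\mathbb{R}$, the cells of the regular subdivision $\mathcal{S}_w(Q)$ are the nonempty sets $\{a\in Q\cap\mathbb{Z}^d: g(a)=w(a)\}$, where $g:\mathbb{R}^d\to\mathbb{R}$ is affine with $g\le w$ on $Q\cap\mathbb{Z}^d$. Weights $\omega_\partial:\mathcal{B}\to\mathbb{R}$ induce on $\partial P$ the collection of all cells of $\mathcal{S}_{\omega_\partial|_F}(F)$, $F$ a facet of $P$. If all these cells are affinely independent, they are (together with $\emptyset$) the faces of a simplicial complex $\Delta$, the *regular triangulation of $\partial P$ induced by $\omega_\partial$*. An $\omega_\partial$-*compatible extension* is a function $\omega:\mathcal{A}\to\mathbb{R}$ with $\omega|_{\mathcal{B}}=\omega_\partial$ and $\partial\mathcal{S}_\omega(P)=\Delta$, where $\partial\mathcal{S}$ consists of the cells of $\mathcal{S}$ contained in a $(d-1)$-dimensional cell that lies in a unique $d$-dimensional cell. *Initial complexes.* For a term order $\prec$ on $R_P$, let $\mathrm{in}_\prec(I)=\langle \mathrm{in}_\prec(f):0\ne f\in I\rangle$. For a simplicial complex $\Delta$ on $\mathcal{A}$ (some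 elements of $\mathcal{A}$ may fail to be vertices) let $I_\Delta=\langle\prod_{\alpha\in\sigma}x_\alpha:\sigma\subseteq\mathcal{A},\ \sigma\notin\Delta\rangle$ be its Stanley–Reisner ideal; $\Delta$ is the *initial complex* of $I$ with respect to $\prec$ if $I_\Delta=\sqrt{\mathrm{in}_\prec(I)}$. For $\omega:\mathcal{A}\to\mathbb{R}$, let $\prec_\omega$ be any term order such that $x^b\prec_\omega x^c$ whenever $x^b,x^c$ have the same total degree and $\sum_\alpha b_\alpha\omega(\alpha)<\sum_\alpha c_\alpha\omega(\alpha)$. **Theorem.** 1. $I_{\partial P}=I_P+M_P$. 2. If $\omega_\partial:\mathcal{B}\to\mathbb{R}$ induces the regular triangulation $\Delta$ of $\partial P$, and $\omega:\mathcal{A}\to\mathbb{R}$ is an $\omega_\partial$-compatible extension, then $\sqrt{\mathrm{in}_{\prec_\omega}(I_{\partial P})}=I_\Delta$. 3. The regular triangulations of $\partial P$ are exactly the initial complexes of $I_{\partial P}$: a simplicial complex $\Delta$ on $\mathcal{A}$ is a regular triangulation of $\partial P$ if and only if it is the initial complex of $I_{\partial P}$ with respect to some term order on $R_P$. -/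

import Mathlib

noncomputable section

namespace BoundarySturmfels

open MvPolynomial

/-! ### Lattice polytopes, facets and boundary -/

/-- The inclusion `ℤ^d ⊆ ℝ^d`. -/
def toReal {d : ℕ} (a : Fin d → ℤ) : Fin d → ℝ := fun i => (a i : ℝ)

/-- `P ⊆ ℝ^d` is a lattice `d`-polytope: the convex hull of finitely many points of `ℤ^d`,
whose affine hull is all of `ℝ^d`. -/
structure IsLatticeDPolytope {d : ℕ} (P : Set (Fin d → ℝ)) : Prop where
  eq_convexHull : ∃ V : Finset (Fin d → ℤ), P = convexHull ℝ (toReal '' (V : Set (Fin d → ℤ)))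
  fullDim : affineSpan ℝ P = ⊤

/-- `F` is a facet of the polytope `P ⊆ ℝ^d`: a nonempty (exposed) face of dimension `d - 1`. -/
structure IsFacet {d : ℕ} (P F : Set (Fin d → ℝ)) : Prop where
  isExposed : IsExposed ℝ P F
  nonempty : F.Nonempty
  finrank_add_one : Module.finrank ℝ (vectorSpan ℝ F) + 1 = d

/-- The boundary `∂P`: the union of all facets of `P`. -/
def boundary {d : ℕ} (P : Set (Fin d → ℝ)) : Set (Fin d → ℝ) :=
  {x | ∃ F, IsFacet P F ∧ x ∈ F}

/-- The lattice points of a subset of `ℝ^d`. In particular `𝒜 = latticePoints P` and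
`ℬ = latticePoints (boundary P)`. -/
def latticePoints {d : ℕ} (Q : Set (Fin d → ℝ)) : Set (Fin d → ℤ) := {a | toReal a ∈ Q}

theorem latticePoints_mono {d : ℕ} {Q Q' : Set (Fin d → ℝ)} (h : Q ⊆ Q') :
    latticePoints Q ⊆ latticePoints Q' := fun _ ha => h ha

theorem IsFacet.subset_boundary {d : ℕ} {P F : Set (Fin d → ℝ)} (hF : IsFacet P F) :
    F ⊆ boundary P := fun _ hx => ⟨F, hF, hx⟩

theorem boundary_subset {d : ℕ} (P : Set (Fin d → ℝ)) : boundary P ⊆ P := by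
  rintro x ⟨F, hF, hx⟩
  exact hF.isExposed.subset hx

/-! ### Regular subdivisions -/

/-- The regular subdivision `𝒮_w(Q)` of `Q` induced by the weights `w` on the lattice points of `Q`.
Each cell is recorded as the (nonempty) set of all lattice points `a` of `Q` whose lift `(a, w a)`
lies on a given lower face of the convex hull of the lifted points: the graph of the affine function
`g` is a non-vertical hyperplane supporting the lifted points from below. Cells of all dimensions
are included. -/
def regularSubdivision {d : ℕ} (Q : Set (Fin d → ℝ)) (w : latticePoints Q → ℝ) :
    Set (Set (Fin d → ℤ)) :=
  {σ | σ.Nonempty ∧ ∃ g : (Fin d → ℝ) →ᵃ[ℝ] ℝ,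
    (∀ a : latticePoints Q, g (toReal a.1) ≤ w a) ∧
    σ = {a | ∃ ha : a ∈ latticePoints Q, g (toReal a) = w ⟨a, ha⟩}}

/-- The regular subdivision of the boundary complex `∂P` induced by weights on the lattice points
of `∂P`: on each facet `F` it is the regular subdivision of `F` induced by the restricted weights. -/
def boundarySubdivision {d : ℕ} (P : Set (Fin d → ℝ)) (w : latticePoints (boundary P) → ℝ) :
    Set (Set (Fin d → ℤ)) :=
  {σ | ∃ (F : Set (Fin d → ℝ)) (hF : IsFacet P F),
    σ ∈ regularSubdivision F
      (fun a => w (Set.inclusion (latticePoints_mono hF.subset_boundary) a))}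

/-- The dimension of the polytope spanned by a (nonempty) set of lattice points. -/
def cellDim {d : ℕ} (σ : Set (Fin d → ℤ)) : ℕ :=
  Module.finrank ℝ (vectorSpan ℝ (toReal '' σ))

/-- The boundary complex `∂𝒮` of a subdivision `𝒮` of a `d`-polytope in `ℝ^d`: the cells contained
in some `(d-1)`-dimensional cell that is contained in a unique `d`-dimensional cell. -/
def boundaryComplex {d : ℕ} (S : Set (Set (Fin d → ℤ))) : Set (Set (Fin d → ℤ)) :=
  {σ | σ ∈ S ∧ ∃ τ ∈ S, σ ⊆ τ ∧ cellDim τ + 1 = d ∧ ∃! ρ, ρ ∈ S ∧ τ ⊆ ρ ∧ cellDim ρ = d}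

/-- The weights `w` on `ℬ` induce the triangulation `Δ` of `∂P`: every cell of the induced
subdivision is a simplex (its lattice points on the lower face are affinely independent), and
the faces of `Δ` are exactly the cells. The empty face is left implicit. -/
structure InducesTriangulation {d : ℕ} (P : Set (Fin d → ℝ))
    (w : latticePoints (boundary P) → ℝ)
    (Δ : PreAbstractSimplicialComplex (latticePoints P)) : Prop where
  affineIndependent : ∀ σ ∈ boundarySubdivision P w,
    AffineIndependent ℝ (fun a : σ => toReal a.1)
  mem_faces_iff : ∀ σ : Finset (latticePoints P),
    σ ∈ Δ.faces ↔ Subtype.val '' (σ : Set (latticePoints P)) ∈ boundarySubdivision P w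

/-- `Δ` is a regular triangulation of `∂P`. -/
def IsRegularBoundaryTriangulation {d : ℕ} (P : Set (Fin d → ℝ))
    (Δ : PreAbstractSimplicialComplex (latticePoints P)) : Prop :=
  ∃ w : latticePoints (boundary P) → ℝ, InducesTriangulation P w Δ

/-- `ω : 𝒜 → ℝ` is a `w`-compatible extension of `w : ℬ → ℝ`: it extends `w`, and the boundary
complex of the regular subdivision of `P` induced by `ω` is the subdivision of `∂P` induced
by `w`. -/
structure IsCompatibleExtension {d : ℕ} (P : Set (Fin d → ℝ))
    (w : latticePoints (boundary P) → ℝ) (ω : latticePoints P → ℝ) : Prop where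
  extends_weight : ∀ b : latticePoints (boundary P),
    ω (Set.inclusion (latticePoints_mono (boundary_subset P)) b) = w b
  boundaryComplex_eq : boundaryComplex (regularSubdivision P ω) = boundarySubdivision P w

/-! ### The Ehrhart ring and the toric boundary ideal -/

/-- The cone over `P × {1}` in `ℝ^d × ℝ = ℝ^{d+1}`. -/
def coneOver {d : ℕ} (P : Set (Fin d → ℝ)) : PointedCone ℝ ((Fin d → ℝ) × ℝ) :=
  PointedCone.hull ℝ (P ×ˢ {(1 : ℝ)})

/-- The inclusion `ℤ^{d+1} ⊆ ℝ^{d+1}`, with the last coordinate split off. -/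
def toRealProd {d : ℕ} (u : (Fin d → ℤ) × ℤ) : (Fin d → ℝ) × ℝ := (toReal u.1, (u.2 : ℝ))

/-- The monoid `S_P = cone(P) ∩ ℤ^{d+1}`. -/
def latticeMonoid {d : ℕ} (P : Set (Fin d → ℝ)) : AddSubmonoid ((Fin d → ℤ) × ℤ) where
  carrier := {u | toRealProd u ∈ coneOver P}
  zero_mem' := by
    have h : toRealProd (0 : (Fin d → ℤ) × ℤ) = 0 := by
      ext <;> simp [toRealProd, toReal]
    simp only [Set.mem_ofPred_eq, h]
    exact zero_mem _
  add_mem' := by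
    intro u v hu hv
    have h : toRealProd (u + v) = toRealProd u + toRealProd v := by
      ext <;> simp [toRealProd, toReal]
    simp only [Set.mem_ofPred_eq, h] at *
    exact add_mem hu hv

/-- `S_P° = cone(P)° ∩ ℤ^{d+1}`. -/
def interiorLattice {d : ℕ} (P : Set (Fin d → ℝ)) : Set ((Fin d → ℤ) × ℤ) :=
  {u | toRealProd u ∈ interior (coneOver P : Set ((Fin d → ℝ) × ℝ))}

theorem lift_mem_latticeMonoid {d : ℕ} {P : Set (Fin d → ℝ)} (a : latticePoints P) :
    ((a.1, 1) : (Fin d → ℤ) × ℤ) ∈ latticeMonoid P := by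
  apply PointedCone.subset_hull
  exact ⟨a.2, by simp [toRealProd]⟩

/-- The Ehrhart ring `𝕂[P] = 𝕂[S_P]`. -/
abbrev EhrhartRing (K : Type*) [Field K] {d : ℕ} (P : Set (Fin d → ℝ)) :=
  AddMonoidAlgebra K (latticeMonoid P)

/-- `φ_P : 𝕂[x_a : a ∈ 𝒜] → 𝕂[P]`, `x_a ↦ t^(a,1)`. -/
def toricMap (K : Type*) [Field K] {d : ℕ} (P : Set (Fin d → ℝ)) :
    MvPolynomial (latticePoints P) K →ₐ[K] EhrhartRing K P :=
  aeval fun a => AddMonoidAlgebra.single ⟨(a.1, 1), lift_mem_latticeMonoid a⟩ (1 : K)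

/-- The interior ideal `J_{P°} = ⟨t^u : u ∈ S_P°⟩` of `𝕂[P]`. -/
def interiorIdeal (K : Type*) [Field K] {d : ℕ} (P : Set (Fin d → ℝ)) :
    Ideal (EhrhartRing K P) :=
  Ideal.span {f | ∃ u : latticeMonoid P, u.1 ∈ interiorLattice P ∧
    f = AddMonoidAlgebra.single u (1 : K)}

/-- The toric boundary ideal `I_{∂P} = φ_P⁻¹(J_{P°})`. -/
def toricBoundaryIdeal (K : Type*) [Field K] {d : ℕ} (P : Set (Fin d → ℝ)) :
    Ideal (MvPolynomial (latticePoints P) K) :=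
  (interiorIdeal K P).comap (toricMap K P)

/-- The toric ideal `I_P = ker φ_P`. -/
def toricIdeal (K : Type*) [Field K] {d : ℕ} (P : Set (Fin d → ℝ)) :
    Ideal (MvPolynomial (latticePoints P) K) :=
  RingHom.ker (toricMap K P)

/-- `γ(c) = ∑ c_a (a, 1)`, the exponent of `φ_P(x^c)`. -/
def gammaExp {d : ℕ} {P : Set (Fin d → ℝ)} (c : latticePoints P →₀ ℕ) : (Fin d → ℤ) × ℤ :=
  c.sum fun a n => n • ((a.1, 1) : (Fin d → ℤ) × ℤ)

/-- The monomial ideal `M_P = ⟨x^c : γ(c) ∈ S_P°⟩`. -/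
def interiorMonomialIdeal (K : Type*) [Field K] {d : ℕ} (P : Set (Fin d → ℝ)) :
    Ideal (MvPolynomial (latticePoints P) K) :=
  Ideal.span {f | ∃ c : latticePoints P →₀ ℕ, gammaExp c ∈ interiorLattice P ∧
    f = monomial c (1 : K)}

/-! ### Initial ideals and Stanley–Reisner ideals -/

/-- The initial ideal of `I` with respect to the term order `m`. -/
def initialIdeal {K : Type*} [Field K] {ι : Type*} (m : MonomialOrder ι)
    (I : Ideal (MvPolynomial ι K)) : Ideal (MvPolynomial ι K) :=
  Ideal.span {g | ∃ f ∈ I, f ≠ 0 ∧ g = monomial (m.degree f) (1 : K)}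

/-- `m` is a term order `≺_ω` induced by the weights `ω`: among monomials of the same total degree,
smaller `ω`-weight means smaller in the order (ties are broken arbitrarily). Comparing only
monomials of equal degree makes sense for weights of arbitrary sign, and suffices since the ideals
considered are homogeneous. -/
def IsWeightOrder {ι : Type*} (ω : ι → ℝ) (m : MonomialOrder ι) : Prop :=
  ∀ b c : ι →₀ ℕ, b.degree = c.degree →
    Finsupp.weight ω b < Finsupp.weight ω c → m.toSyn b < m.toSyn c

/-- The Stanley–Reisner ideal of a simplicial complex: it is generated by the squarefree monomials
of the nonfaces. The empty set counts as a face, although it is not listed in `Δ.faces`. -/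
def stanleyReisnerIdeal (K : Type*) [Field K] {ι : Type*} (Δ : PreAbstractSimplicialComplex ι) :
    Ideal (MvPolynomial ι K) :=
  Ideal.span {f | ∃ σ : Finset ι, σ.Nonempty ∧ σ ∉ Δ.faces ∧ f = ∏ a ∈ σ, X a}

/-- `Δ` is the initial complex of `I` with respect to the term order `m`. -/
def IsInitialComplex {K : Type*} [Field K] {ι : Type*} (m : MonomialOrder ι)
    (I : Ideal (MvPolynomial ι K)) (Δ : PreAbstractSimplicialComplex ι) : Prop :=
  stanleyReisnerIdeal K Δ = (initialIdeal m I).radical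

end BoundarySturmfels

end

open BoundarySturmfels

noncomputable section

namespace BoundarySturmfels

open MvPolynomial

/-! ### A Farkas lemma with integral certificates -/

/-! The ideal $I_{\partial P}$ is graded by $S_P$: in degrees inside the cone it contains every
monomial, in the other degrees it agrees with $I_P$. Splitting a polynomial accordingly gives part
1. It also determines every initial ideal (`initialIdeal_toricBoundaryIdeal`): a monomial $x^c$ is
standard exactly when $\gamma(c)\notin S_P^\circ$ and $c$ is the smallest element of its fibre
$\{b:\gamma(b)=\gamma(c)\}$. Hence $\Delta$ is the initial complex if and only if its faces are the
nonempty $\sigma$ such that all powers of $x^\sigma$ are standard (`isInitialComplex_iff`).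

Nontrivial monomials not over the interior are supported on a facet $F$
(`IsLatticeDPolytope.exists_facet`), and then so is their whole fibre (`IsFacet.support_subset`).
Minimising the weight in such a fibre is an integer program, to which linear programming duality
applies. An affine function below $\omega$ on $F$ gives a lower bound for the weights in the fibre,
attained exactly on its cell. If no such function is tight on $\sigma$, then `farkas`, whose
multipliers are natural numbers, produces a monomial in the fibre of a power of $x^\sigma$ with
strictly smaller weight. When the cells are simplices, monomials on a cell are the unique lightest
ones in their fibres, so for a weight order the faces are the cells.

For the converse, a term order is replaced by weights: by Dickson's lemma finitely many comparisons
matter, and Farkas realises them by some $\omega$ for which each standard monomial is the unique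
lightest one in its fibre. Two monomials on one cell with equal $\gamma$ are both lightest, hence
equal; so the cells have no integral relations and are simplices, and the duality argument
identifies them with the faces of $\Delta$. -/

theorem exists_between_of_finite {L U : Set ℝ} (hL : L.Finite) (hU : U.Finite)
    (h : ∀ l ∈ L, ∀ u ∈ U, l ≤ u) : ∃ x, (∀ l ∈ L, l ≤ x) ∧ ∀ u ∈ U, x ≤ u := by
  rcases L.eq_empty_or_nonempty with rfl | hne
  · obtain ⟨x, hx⟩ := hU.bddBelow
    exact ⟨x, by simp, fun u hu => hx hu⟩
  · exact ⟨sSup L, fun l hl => le_csSup hL.bddAbove hl,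
      fun u hu => csSup_le hne fun l hl => h l hl u hu⟩

/-- The inclusion of linear inequalities in `n` variables into those in `n + 1` variables. -/
def consZero (n : ℕ) : ((Fin n → ℤ) × ℝ) →+ ((Fin (n + 1) → ℤ) × ℝ) where
  toFun s := (Fin.cons 0 s.1, s.2)
  map_zero' := by
    ext i
    · refine Fin.cases ?_ (fun j => ?_) i <;> simp
    · simp
  map_add' s t := by
    ext i
    · refine Fin.cases ?_ (fun j => ?_) i <;> simp
    · simp

theorem consZero_injective (n : ℕ) : Function.Injective (consZero n) := by
  rintro ⟨a, b⟩ ⟨a', b'⟩ h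
  simp only [consZero, AddMonoidHom.coe_mk, ZeroHom.coe_mk, Prod.mk.injEq] at h
  rw [Prod.mk.injEq]
  exact ⟨Fin.cons_right_injective (α := fun _ => ℤ) (0 : ℤ) h.1, h.2⟩

theorem consZero_tail {n : ℕ} {s : (Fin (n + 1) → ℤ) × ℝ} (h : s.1 0 = 0) :
    consZero n (Fin.tail s.1, s.2) = s := by
  ext i
  · refine Fin.cases ?_ (fun j => ?_) i <;> simp [consZero, h, Fin.tail]
  · simp [consZero]

/-- Fourier–Motzkin elimination: a finite system of linear inequalities with integral coefficients
and real right hand sides is solvable, or it implies `0 ≤ β` for some `β < 0` by adding up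
some of the inequalities. -/
theorem fourierMotzkin (n : ℕ) (S : Set ((Fin n → ℤ) × ℝ)) (hS : S.Finite) :
    (∃ x : Fin n → ℝ, ∀ s ∈ S, ∑ k, (s.1 k : ℝ) * x k ≤ s.2) ∨
      ∃ β < (0 : ℝ), ((0, β) : (Fin n → ℤ) × ℝ) ∈ AddSubmonoid.closure S := by
  induction n with
  | zero =>
    by_cases h : ∀ s ∈ S, 0 ≤ s.2
    · exact Or.inl ⟨0, fun s hs => by simpa using h s hs⟩
    · push Not at h
      obtain ⟨s, hs, hs0⟩ := h
      refine Or.inr ⟨s.2, hs0, ?_⟩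
      have : ((0, s.2) : (Fin 0 → ℤ) × ℝ) = s := Prod.ext (Subsingleton.elim _ _) rfl
      rw [this]
      exact AddSubmonoid.subset_closure hs
  | succ n ih =>
    -- The combination of $p$ and $q$ that cancels variable $0$. It is used only for $p_0>0>q_0$,
    -- where `toNat` does not truncate; natural multipliers keep it in the submonoid generated by
    -- $S$.
    set f : ((Fin (n + 1) → ℤ) × ℝ) → ((Fin (n + 1) → ℤ) × ℝ) → ((Fin (n + 1) → ℤ) × ℝ) :=
      fun p q => (-(q.1 0)).toNat • p + (p.1 0).toNat • q with hf
    set T : Set ((Fin (n + 1) → ℤ) × ℝ) :=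
      {s ∈ S | s.1 0 = 0} ∪ Set.image2 f {p ∈ S | 0 < p.1 0} {q ∈ S | q.1 0 < 0} with hT
    have hTfin : T.Finite :=
      (hS.subset (Set.sep_subset _ _)).union
        ((hS.subset (Set.sep_subset _ _)).image2 _ (hS.subset (Set.sep_subset _ _)))
    have hTcl : T ⊆ AddSubmonoid.closure S := by
      rintro s (hs | ⟨p, hp, q, hq, rfl⟩)
      · exact AddSubmonoid.subset_closure hs.1
      · exact add_mem (AddSubmonoid.nsmul_mem _ (AddSubmonoid.subset_closure hp.1) _)
          (AddSubmonoid.nsmul_mem _ (AddSubmonoid.subset_closure hq.1) _)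
    have hf1 : ∀ p q : (Fin (n + 1) → ℤ) × ℝ, 0 < p.1 0 → q.1 0 < 0 → ∀ k,
        (f p q).1 k = -(q.1 0) * p.1 k + p.1 0 * q.1 k := by
      intro p q hp hq k
      have h1 : ((-(q.1 0)).toNat : ℤ) = -(q.1 0) := Int.toNat_of_nonneg (by omega)
      have h2 : ((p.1 0).toNat : ℤ) = p.1 0 := Int.toNat_of_nonneg (by omega)
      simp only [hf, Prod.fst_add, Prod.smul_fst, Pi.add_apply, Pi.smul_apply]
      rw [nsmul_eq_mul, nsmul_eq_mul, h1, h2]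
    have hf2 : ∀ p q : (Fin (n + 1) → ℤ) × ℝ, 0 < p.1 0 → q.1 0 < 0 →
        (f p q).2 = -(q.1 0 : ℝ) * p.2 + (p.1 0 : ℝ) * q.2 := by
      intro p q hp hq
      have h1 : ((-(q.1 0)).toNat : ℝ) = -(q.1 0 : ℝ) := by
        exact_mod_cast congrArg (Int.cast : ℤ → ℝ)
          (Int.toNat_of_nonneg (a := -(q.1 0)) (by omega))
      have h2 : ((p.1 0).toNat : ℝ) = (p.1 0 : ℝ) := by
        exact_mod_cast congrArg (Int.cast : ℤ → ℝ) (Int.toNat_of_nonneg (a := p.1 0) (by omega))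
      simp only [hf, Prod.snd_add, Prod.smul_snd]
      rw [nsmul_eq_mul, nsmul_eq_mul, h1, h2]
    have hT0 : ∀ s ∈ T, s.1 0 = 0 := by
      rintro s (hs | ⟨p, hp, q, hq, rfl⟩)
      · exact hs.2
      · rw [hf1 p q hp.2 hq.2]; ring
    rcases ih (consZero n ⁻¹' T) (hTfin.preimage (consZero_injective n).injOn) with
      ⟨x, hx⟩ | ⟨β, hβ, hmem⟩
    · left
      have hx' : ∀ s ∈ T, ∑ k : Fin n, (s.1 k.succ : ℝ) * x k ≤ s.2 := by
        intro s hs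
        exact hx (Fin.tail s.1, s.2) (by rw [Set.mem_preimage, consZero_tail (hT0 s hs)]; exact hs)
      set r : ((Fin (n + 1) → ℤ) × ℝ) → ℝ := fun s => s.2 - ∑ k : Fin n, (s.1 k.succ : ℝ) * x k
        with hr
      -- Rows with negative leading coefficient bound the eliminated variable from below, those with
      -- positive one from above; the rows in $T$ say that the bounds are compatible.
      obtain ⟨y, hy1, hy2⟩ := exists_between_of_finite
        (L := (fun q => r q / (q.1 0 : ℝ)) '' {q ∈ S | q.1 0 < 0})
        (U := (fun q => r q / (q.1 0 : ℝ)) '' {p ∈ S | 0 < p.1 0})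
        ((hS.subset (Set.sep_subset _ _)).image _) ((hS.subset (Set.sep_subset _ _)).image _) (by
          rintro _ ⟨q, hq, rfl⟩ _ ⟨p, hp, rfl⟩
          have h := hx' (f p q) (Or.inr ⟨p, hp, q, hq, rfl⟩)
          rw [hf2 p q hp.2 hq.2] at h
          simp only [hf1 p q hp.2 hq.2] at h
          have hp0 : (0 : ℝ) < p.1 0 := by exact_mod_cast hp.2
          have hq0 : (q.1 0 : ℝ) < 0 := by exact_mod_cast hq.2
          have h' : ∑ k : Fin n, ((-(q.1 0) * p.1 k.succ + p.1 0 * q.1 k.succ : ℤ) : ℝ) * x k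
              = -(q.1 0 : ℝ) * ∑ k : Fin n, (p.1 k.succ : ℝ) * x k
                + (p.1 0 : ℝ) * ∑ k : Fin n, (q.1 k.succ : ℝ) * x k := by
            rw [Finset.mul_sum, Finset.mul_sum, ← Finset.sum_add_distrib]
            refine Finset.sum_congr rfl fun k _ => ?_
            push_cast; ring
          rw [h'] at h
          have key : 0 ≤ -(q.1 0 : ℝ) * r p + p.1 0 * r q := by
            simp only [hr]; linarith
          change r q / (q.1 0 : ℝ) ≤ r p / (p.1 0 : ℝ)
          rw [div_le_iff_of_neg hq0, div_mul_eq_mul_div, div_le_iff₀ hp0]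
          linarith)
      refine ⟨Fin.cons y x, fun s hs => ?_⟩
      rw [Fin.sum_univ_succ]
      simp only [Fin.cons_zero, Fin.cons_succ]
      suffices h : (s.1 0 : ℝ) * y ≤ r s by simp only [hr] at h; linarith
      rcases lt_trichotomy (s.1 0) 0 with h0 | h0 | h0
      · have h := hy1 _ ⟨s, ⟨hs, h0⟩, rfl⟩
        have hq0 : (s.1 0 : ℝ) < 0 := by exact_mod_cast h0
        simp only at h
        rw [div_le_iff_of_neg hq0] at h
        linarith
      · have h := hx' s (Or.inl ⟨hs, h0⟩)
        simp only [hr, h0]; push_cast; linarith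
      · have h := hy2 _ ⟨s, ⟨hs, h0⟩, rfl⟩
        have hp0 : (0 : ℝ) < s.1 0 := by exact_mod_cast h0
        simp only at h
        rw [le_div_iff₀ hp0] at h
        linarith
    · right
      refine ⟨β, hβ, ?_⟩
      have h1 : consZero n (0, β) ∈ (AddSubmonoid.closure (consZero n ⁻¹' T)).map (consZero n) :=
        ⟨_, hmem, rfl⟩
      have h2 : consZero n (0, β) = (0, β) := by
        have := consZero_tail (n := n) (s := (0, β)) rfl
        rwa [show Fin.tail (0 : Fin (n + 1) → ℤ) = 0 from rfl] at this
      rw [AddMonoidHom.map_mclosure, h2] at h1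
      have h3 : AddSubmonoid.closure (consZero n '' (consZero n ⁻¹' T)) ≤ AddSubmonoid.closure S :=
        AddSubmonoid.closure_le.2 ((Set.image_preimage_subset _ _).trans hTcl)
      exact h3 h1

/-- Farkas' lemma: if a finite system of linear inequalities with integral coefficients has no
solution, then this is certified by natural numbers. -/
theorem farkas {ι κ : Type*} [Fintype ι] [Fintype κ] (A : ι → κ → ℤ) (b : ι → ℝ)
    (h : ¬ ∃ x : κ → ℝ, ∀ i, ∑ k, (A i k : ℝ) * x k ≤ b i) :
    ∃ y : ι → ℕ, (∀ k, ∑ i, (y i : ℤ) * A i k = 0) ∧ ∑ i, (y i : ℝ) * b i < 0 := by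
  let e := Fintype.equivFin κ
  let f : ι → (Fin (Fintype.card κ) → ℤ) × ℝ := fun i => (fun k => A i (e.symm k), b i)
  rcases fourierMotzkin _ (Set.range f) (Set.finite_range f) with ⟨x, hx⟩ | ⟨β, hβ, hmem⟩
  · refine absurd ⟨fun k => x (e k), fun i => ?_⟩ h
    refine le_trans (le_of_eq ?_) (hx _ ⟨i, rfl⟩)
    exact Fintype.sum_equiv e _ _ fun k => by simp [f]
  · obtain ⟨y, hy⟩ := AddSubmonoid.mem_closure_range_iff_of_fintype.1 hmem
    refine ⟨y, fun k => ?_, ?_⟩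
    · have := congrFun (congrArg Prod.fst hy) (e k)
      simpa [f, Prod.fst_sum] using this.symm
    · have := congrArg Prod.snd hy
      simp only [f, Prod.snd_sum, Prod.smul_snd] at this
      simp only [nsmul_eq_mul] at this
      rw [← this]; exact hβ

/-! ### Monomial ideals and Stanley–Reisner ideals -/

/-- The exponent vector of the squarefree monomial with support `σ`. -/
def oneOn {ι : Type*} (σ : Finset ι) : ι →₀ ℕ := ∑ a ∈ σ, Finsupp.single a 1

open Classical in
theorem oneOn_apply {ι : Type*} (σ : Finset ι) (a : ι) : oneOn σ a = if a ∈ σ then 1 else 0 := by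
  simp [oneOn, Finsupp.finsetSum_apply, Finsupp.single_apply]

theorem oneOn_apply_mem {ι : Type*} {σ : Finset ι} {a : ι} (h : a ∈ σ) : oneOn σ a = 1 := by
  classical simp [oneOn_apply, h]

theorem oneOn_apply_notMem {ι : Type*} {σ : Finset ι} {a : ι} (h : a ∉ σ) : oneOn σ a = 0 := by
  classical simp [oneOn_apply, h]

theorem mem_of_nsmul_oneOn_ne_zero {ι : Type*} {σ : Finset ι} {n : ℕ} {a : ι}
    (h : (n • oneOn σ) a ≠ 0) : a ∈ σ := by
  by_contra ha
  simp [oneOn_apply_notMem ha] at h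

theorem prod_X_eq_monomial_oneOn {K : Type*} [Field K] {ι : Type*} (σ : Finset ι) :
    ∏ a ∈ σ, (X a : MvPolynomial ι K) = monomial (oneOn σ) 1 := by
  rw [oneOn, monomial_sum_one]; rfl

theorem oneOn_le_iff {ι : Type*} {σ : Finset ι} {c : ι →₀ ℕ} : oneOn σ ≤ c ↔ σ ⊆ c.support := by
  classical
  constructor
  · intro h a ha
    have := h a
    rw [oneOn_apply_mem ha] at this
    rw [Finsupp.mem_support_iff]; omega
  · intro h a
    by_cases ha : a ∈ σ
    · rw [oneOn_apply_mem ha]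
      exact Nat.one_le_iff_ne_zero.2 (Finsupp.mem_support_iff.1 (h ha))
    · rw [oneOn_apply_notMem ha]; exact Nat.zero_le _

theorem exists_le_nsmul_oneOn {ι : Type*} {σ : Finset ι} {c : ι →₀ ℕ} (h : c.support ⊆ σ) :
    ∃ n : ℕ, c ≤ n • oneOn σ := by
  refine ⟨∑ a ∈ c.support, c a, fun a => ?_⟩
  by_cases ha : a ∈ c.support
  · simpa [oneOn_apply_mem (h ha)] using
      Finset.single_le_sum (f := fun a => c a) (fun _ _ => Nat.zero_le _) ha
  · rw [Finsupp.notMem_support_iff.1 ha]; exact Nat.zero_le _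

/-- Divisibility by a squarefree monomial depends only on the support, and a nonempty subset of a
face is a face. -/
theorem mem_stanleyReisnerIdeal {K : Type*} [Field K] {ι : Type*}
    {Δ : PreAbstractSimplicialComplex ι} {f : MvPolynomial ι K} :
    f ∈ stanleyReisnerIdeal K Δ ↔
      ∀ c ∈ f.support, c.support.Nonempty ∧ c.support ∉ Δ.faces := by
  have h : {f : MvPolynomial ι K | ∃ σ : Finset ι, σ.Nonempty ∧ σ ∉ Δ.faces ∧ f = ∏ a ∈ σ, X a} =
      (fun c => monomial c (1 : K)) '' (oneOn '' {σ : Finset ι | σ.Nonempty ∧ σ ∉ Δ.faces}) := by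
    ext g
    simp only [prod_X_eq_monomial_oneOn, Set.mem_image, Set.mem_ofPred_eq]
    constructor
    · rintro ⟨σ, h1, h2, rfl⟩
      exact ⟨_, ⟨σ, ⟨h1, h2⟩, rfl⟩, rfl⟩
    · rintro ⟨_, ⟨σ, ⟨h1, h2⟩, rfl⟩, rfl⟩
      exact ⟨σ, h1, h2, rfl⟩
  rw [stanleyReisnerIdeal, h, mem_ideal_span_monomial_image]
  refine forall₂_congr fun c _ => ?_
  constructor
  · rintro ⟨_, ⟨σ, ⟨h1, h2⟩, rfl⟩, hle⟩
    rw [oneOn_le_iff] at hle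
    exact ⟨h1.mono hle, fun hc => h2 ((Δ.isRelLowerSet_faces hc).2 hle h1)⟩
  · rintro ⟨h1, h2⟩
    exact ⟨_, ⟨_, ⟨h1, h2⟩, rfl⟩, oneOn_le_iff.2 subset_rfl⟩

theorem support_oneOn {ι : Type*} (σ : Finset ι) : (oneOn σ).support = σ := by
  ext a
  by_cases h : a ∈ σ <;> simp [h, oneOn_apply_mem, oneOn_apply_notMem]

theorem monomial_mem_span_monomial {K : Type*} [Field K] {ι : Type*} {N : Set (ι →₀ ℕ)}
    (hN : IsUpperSet N) {c : ι →₀ ℕ} :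
    monomial c (1 : K) ∈ Ideal.span ((fun c => monomial c (1 : K)) '' N) ↔ c ∈ N := by
  rw [mem_ideal_span_monomial_image]
  classical
  constructor
  · intro h
    obtain ⟨b, hb, hle⟩ := h c (by simp [support_monomial])
    exact hN hle hb
  · intro h b hb
    rw [support_monomial, if_neg one_ne_zero, Finset.mem_singleton] at hb
    exact ⟨c, h, hb.ge⟩

theorem monomial_oneOn_mem_radical_iff {K : Type*} [Field K] {ι : Type*} {N : Set (ι →₀ ℕ)}
    (hN : IsUpperSet N) {σ : Finset ι} :
    monomial (oneOn σ) (1 : K) ∈ (Ideal.span ((fun c => monomial c (1 : K)) '' N)).radical ↔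
      ∃ n : ℕ, n • oneOn σ ∈ N := by
  simp only [Ideal.mem_radical_iff, monomial_pow, one_pow, monomial_mem_span_monomial hN]

/-- The radical of the monomial ideal with exponent set `N` is the Stanley–Reisner ideal of `Δ` if
and only if the nonfaces of `Δ` are the supports of the monomials having a power in the ideal. -/
theorem stanleyReisnerIdeal_eq_radical_iff {K : Type*} [Field K] {ι : Type*} {N : Set (ι →₀ ℕ)}
    (hN : IsUpperSet N) (h0 : 0 ∉ N) (Δ : PreAbstractSimplicialComplex ι) :
    stanleyReisnerIdeal K Δ = (Ideal.span ((fun c => monomial c (1 : K)) '' N)).radical ↔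
      ∀ σ : Finset ι, σ.Nonempty → (σ ∈ Δ.faces ↔ ∀ n : ℕ, n • oneOn σ ∉ N) := by
  classical
  constructor
  · intro h σ hσ
    rw [← not_iff_not]
    push Not
    rw [← monomial_oneOn_mem_radical_iff (K := K) hN, ← h, mem_stanleyReisnerIdeal]
    simp only [support_monomial, if_neg (one_ne_zero (α := K)), Finset.mem_singleton, forall_eq,
      support_oneOn, hσ, true_and]
  · intro h
    apply le_antisymm
    · rw [stanleyReisnerIdeal, Ideal.span_le]
      rintro _ ⟨σ, h1, h2, rfl⟩
      rw [prod_X_eq_monomial_oneOn, SetLike.mem_coe, monomial_oneOn_mem_radical_iff hN]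
      rw [h σ h1] at h2
      push Not at h2
      exact h2
    · intro f hf
      rw [mem_stanleyReisnerIdeal]
      by_contra hcon
      push Not at hcon
      obtain ⟨c, hc, hcΔ⟩ := hcon
      -- Such a monomial divides a power of the squarefree monomial on the support of $c$; the empty
      -- support is covered by `h0`.
      have hstd : ∀ b : ι →₀ ℕ, b.support ⊆ c.support → b ∉ N := by
        intro b hb hbN
        rcases c.support.eq_empty_or_nonempty with he | hne
        · rw [he, Finset.subset_empty, Finsupp.support_eq_empty] at hb
          exact h0 (hb ▸ hbN)
        · obtain ⟨n, hn⟩ := exists_le_nsmul_oneOn hb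
          exact (h _ hne).1 (hcΔ hne) n (hN hn hbN)
      -- Setting the variables outside the support of $c$ to zero kills the monomial ideal and
      -- preserves the coefficient of $x^c$ in $f$. As the target is reduced, no power of $f$ lies
      -- in the ideal.
      let π : MvPolynomial ι K →ₐ[K] MvPolynomial ι K :=
        aeval fun a => if a ∈ c.support then X a else 0
      have hπ : ∀ b : ι →₀ ℕ, ∀ k : K,
          π (monomial b k) = if b.support ⊆ c.support then monomial b k else 0 := by
        intro b k
        simp only [π, aeval_monomial]
        split_ifs with hb
        · rw [monomial_eq, algebraMap_eq]
          congr 1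
          refine Finsupp.prod_congr fun a ha => ?_
          rw [if_pos (hb ha)]
        · obtain ⟨a, ha, hac⟩ := Finset.not_subset.1 hb
          rw [Finsupp.prod, Finset.prod_eq_zero ha, mul_zero]
          rw [if_neg hac, zero_pow (Finsupp.mem_support_iff.1 ha)]
      have hcoeff : coeff c (π f) = coeff c f := by
        conv_lhs => rw [f.as_sum, map_sum, coeff_sum]
        rw [Finset.sum_eq_single c]
        · rw [hπ, if_pos subset_rfl, coeff_monomial, if_pos rfl]
        · intro b _ hbc
          rw [hπ]
          split_ifs
          · rw [coeff_monomial, if_neg hbc]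
          · simp
        · intro hcn
          exact absurd hc hcn
      have hne : π f ≠ 0 := by
        intro hz
        rw [hz, coeff_zero] at hcoeff
        exact mem_support_iff.1 hc hcoeff.symm
      obtain ⟨n, hn⟩ := hf
      have hker : Ideal.span ((fun c => monomial c (1 : K)) '' N) ≤ RingHom.ker π := by
        rw [Ideal.span_le]
        rintro _ ⟨b, hb, rfl⟩
        rw [SetLike.mem_coe, RingHom.mem_ker, hπ, if_neg fun hs => hstd b hs hb]
      have := hker hn
      rw [RingHom.mem_ker, map_pow] at this
      exact hne (eq_zero_of_pow_eq_zero this)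

/-! ### Weight orders -/

/-- Monomials ordered by degree, then by weight, then by a given term order. -/
def weightKey {ι : Type*} (ω : ι → ℝ) (m : MonomialOrder ι) (c : ι →₀ ℕ) :
    ℕ ×ₗ (ℝ ×ₗ m.syn) :=
  toLex (c.degree, toLex (Finsupp.weight ω c, m.toSyn c))

theorem weightKey_injective {ι : Type*} (ω : ι → ℝ) (m : MonomialOrder ι) :
    Function.Injective (weightKey ω m) := by
  intro b c h
  simp only [weightKey, EmbeddingLike.apply_eq_iff_eq, Prod.mk.injEq] at h
  exact h.2.2

theorem weightKey_add_le {ι : Type*} (ω : ι → ℝ) (m : MonomialOrder ι) {b c : ι →₀ ℕ}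
    (h : weightKey ω m b ≤ weightKey ω m c) (e : ι →₀ ℕ) :
    weightKey ω m (b + e) ≤ weightKey ω m (c + e) := by
  simp only [weightKey, Prod.Lex.toLex_le_toLex, map_add] at h ⊢
  rcases h with h | ⟨h1, h | ⟨h2, h3⟩⟩
  · exact Or.inl (by simpa using h)
  · exact Or.inr ⟨by rw [h1], Or.inl (by simpa using h)⟩
  · exact Or.inr ⟨by rw [h1], Or.inr ⟨by rw [h2], by simpa using h3⟩⟩

/-- The degree is compared first, so a proper multiple is larger even if some weights are negative.
-/
theorem weightKey_mono {ι : Type*} (ω : ι → ℝ) (m : MonomialOrder ι) :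
    Monotone (weightKey ω m) := by
  intro b c h
  rcases eq_or_ne b c with rfl | hne
  · exact le_rfl
  · obtain ⟨e, rfl⟩ := exists_add_of_le h
    simp only [weightKey, Prod.Lex.toLex_le_toLex]
    left
    have : e ≠ 0 := by rintro rfl; simp at hne
    have h1 : e.degree ≠ 0 := by rwa [Ne, Finsupp.degree_eq_zero_iff]
    have h2 : (b + e).degree = b.degree + e.degree := map_add _ _ _
    change b.degree < (b + e).degree
    omega

/-- A copy of `ι →₀ ℕ`, to be ordered by degree, weight and a term order. -/
def WeightSyn {ι : Type*} (_ω : ι → ℝ) (_m : MonomialOrder ι) : Type _ := ι →₀ ℕ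

instance {ι : Type*} (ω : ι → ℝ) (m : MonomialOrder ι) : AddCommMonoid (WeightSyn ω m) :=
  inferInstanceAs (AddCommMonoid (ι →₀ ℕ))

instance {ι : Type*} (ω : ι → ℝ) (m : MonomialOrder ι) : LinearOrder (WeightSyn ω m) :=
  LinearOrder.lift' (weightKey ω m) (weightKey_injective ω m)

instance {ι : Type*} (ω : ι → ℝ) (m : MonomialOrder ι) : IsOrderedAddMonoid (WeightSyn ω m) where
  add_le_add_left _ _ h e := weightKey_add_le ω m h e

/-- Dickson's lemma: the order extends divisibility, which is a well-quasi-order on monomials in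
finitely many variables. -/
instance {ι : Type*} [Finite ι] (ω : ι → ℝ) (m : MonomialOrder ι) :
    WellFoundedLT (WeightSyn ω m) := by
  rw [← wellQuasiOrderedLE_iff_wellFoundedLT]
  refine ⟨fun f => ?_⟩
  obtain ⟨i, j, hij, h⟩ := wellQuasiOrdered_le (α := ι →₀ ℕ) f
  exact ⟨i, j, hij, weightKey_mono ω m h⟩

/-- The term order comparing degrees, then weights, then the exponents with respect to `m`. -/
def weightOrder {ι : Type*} [Finite ι] (ω : ι → ℝ) (m : MonomialOrder ι) : MonomialOrder ι where
  syn := WeightSyn ω m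
  toSyn :=
    { toFun := fun c => c
      invFun := fun c => c
      map_add' := fun _ _ => rfl }
  toSyn_monotone _ _ h := weightKey_mono ω m h

theorem isWeightOrder_weightOrder {ι : Type*} [Finite ι] (ω : ι → ℝ) (m : MonomialOrder ι) :
    IsWeightOrder ω (weightOrder ω m) := by
  intro b c hd hw
  change weightKey ω m b < weightKey ω m c
  simp only [weightKey, Prod.Lex.toLex_lt_toLex]
  exact Or.inr ⟨hd, Or.inl hw⟩

theorem exists_isWeightOrder {ι : Type} [Finite ι] (ω : ι → ℝ) :
    ∃ m : MonomialOrder.{0, 0} ι, IsWeightOrder ω m := by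
  classical
  let : LinearOrder ι := linearOrderOfSTO WellOrderingRel
  exact ⟨weightOrder ω MonomialOrder.lex, isWeightOrder_weightOrder _ _⟩

/-! ### The toric boundary ideal and its initial ideals -/

section Toric

variable {K : Type*} [Field K] {d : ℕ} {P : Set (Fin d → ℝ)}

theorem toRealProd_add (u v : (Fin d → ℤ) × ℤ) :
    toRealProd (u + v) = toRealProd u + toRealProd v := by
  ext <;> simp [toRealProd, toReal]

theorem toRealProd_nsmul (n : ℕ) (u : (Fin d → ℤ) × ℤ) :
    toRealProd (n • u) = (n : ℝ) • toRealProd u := by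
  ext <;> simp [toRealProd, toReal]

theorem gammaExp_zero : gammaExp (0 : latticePoints P →₀ ℕ) = 0 := by simp [gammaExp]

theorem gammaExp_add (b c : latticePoints P →₀ ℕ) :
    gammaExp (b + c) = gammaExp b + gammaExp c :=
  Finsupp.sum_add_index' (fun _ => zero_nsmul _) fun _ _ _ => add_nsmul _ _ _

theorem gammaExp_single (a : latticePoints P) (n : ℕ) :
    gammaExp (Finsupp.single a n) = n • ((a.1, 1) : (Fin d → ℤ) × ℤ) :=
  Finsupp.sum_single_index (zero_nsmul _)

theorem gammaExp_mem (c : latticePoints P →₀ ℕ) : gammaExp c ∈ latticeMonoid P :=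
  AddSubmonoid.sum_mem _ fun a _ => AddSubmonoid.nsmul_mem _ (lift_mem_latticeMonoid a) _

/-- `γ(c)` as an element of `S_P`. -/
def gammaElem (c : latticePoints P →₀ ℕ) : latticeMonoid P := ⟨gammaExp c, gammaExp_mem c⟩

theorem gammaElem_eq_iff {b c : latticePoints P →₀ ℕ} :
    gammaElem b = gammaElem c ↔ gammaExp b = gammaExp c := Subtype.ext_iff

theorem toricMap_monomial (c : latticePoints P →₀ ℕ) (k : K) :
    toricMap K P (monomial c k) = AddMonoidAlgebra.single (gammaElem c) k := by
  induction c using Finsupp.induction generalizing k with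
  | zero =>
    have h : gammaElem (0 : latticePoints P →₀ ℕ) = 0 := Subtype.ext (gammaExp_zero (P := P))
    rw [h, ← C_apply, ← algebraMap_eq, AlgHom.commutes]
    rfl
  | single_add a n c _ _ ih =>
    have h1 : monomial (Finsupp.single a n + c) k = (X a) ^ n * monomial c k := by
      rw [X_pow_eq_monomial, monomial_mul, one_mul]
    have h2 : gammaElem (Finsupp.single a n + c) =
        n • (⟨(a.1, 1), lift_mem_latticeMonoid a⟩ : latticeMonoid P) + gammaElem c := by
      apply Subtype.ext
      change gammaExp (Finsupp.single a n + c) = n • ((a.1, 1) : (Fin d → ℤ) × ℤ) + gammaExp c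
      rw [gammaExp_add, gammaExp_single]
    rw [h1, map_mul, map_pow, ih, h2, toricMap, aeval_X, AddMonoidAlgebra.single_pow,
      AddMonoidAlgebra.single_mul_single, one_pow, one_mul]

open Classical in
theorem coeff_toricMap (f : MvPolynomial (latticePoints P) K) (u : latticeMonoid P) :
    (toricMap K P f).coeff u = ∑ c ∈ f.support with gammaElem c = u, coeff c f := by
  conv_lhs => rw [f.as_sum, map_sum]
  rw [AddMonoidAlgebra.coeff_sum, Finsupp.finsetSum_apply, Finset.sum_filter]
  refine Finset.sum_congr rfl fun c _ => ?_
  rw [toricMap_monomial, AddMonoidAlgebra.coeff_single, Finsupp.single_apply]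

theorem interior_add_mem {C : PointedCone ℝ ((Fin d → ℝ) × ℝ)} {x y : (Fin d → ℝ) × ℝ}
    (hx : x ∈ interior (C : Set ((Fin d → ℝ) × ℝ))) (hy : y ∈ C) :
    x + y ∈ interior (C : Set ((Fin d → ℝ) × ℝ)) := by
  rw [mem_interior] at hx ⊢
  obtain ⟨U, hUC, hU, hxU⟩ := hx
  refine ⟨(fun z => z + y) '' U, ?_, (Homeomorph.addRight y).isOpenMap U hU, ⟨x, hxU, rfl⟩⟩
  rintro _ ⟨z, hz, rfl⟩
  exact add_mem (hUC hz) hy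

theorem interiorLattice_add {u v : (Fin d → ℤ) × ℤ} (hu : u ∈ interiorLattice P)
    (hv : v ∈ latticeMonoid P) : u + v ∈ interiorLattice P := by
  change toRealProd (u + v) ∈ interior _
  rw [toRealProd_add]
  exact interior_add_mem hu hv

/-- Adding an element of $S_P$ to one of $S_P^\circ$ stays in $S_P^\circ$, so the monomials $t^u$,
$u\in S_P^\circ$, already span the ideal as a vector space. -/
theorem mem_interiorIdeal {f : EhrhartRing K P} :
    f ∈ interiorIdeal K P ↔ ∀ u : latticeMonoid P, u.1 ∉ interiorLattice P → f.coeff u = 0 := by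
  have h : {f : EhrhartRing K P | ∃ u : latticeMonoid P, u.1 ∈ interiorLattice P ∧
      f = AddMonoidAlgebra.single u (1 : K)} =
      AddMonoidAlgebra.of' K (latticeMonoid P) '' {u | u.1 ∈ interiorLattice P} := by
    ext g
    constructor
    · rintro ⟨u, hu, rfl⟩
      exact ⟨u, hu, rfl⟩
    · rintro ⟨u, hu, rfl⟩
      exact ⟨u, hu, rfl⟩
  rw [interiorIdeal, h, AddMonoidAlgebra.mem_ideal_span_of'_image]
  refine forall_congr' fun u => ?_
  rw [Finsupp.mem_support_iff, ← not_imp_not, not_not]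
  refine imp_congr (not_congr ?_) Iff.rfl
  constructor
  · rintro ⟨v, hv, t, rfl⟩
    rw [add_comm t v]
    exact interiorLattice_add hv t.2
  · exact fun hu => ⟨u, hu, 0, (zero_add u).symm⟩

theorem mem_toricBoundaryIdeal {f : MvPolynomial (latticePoints P) K} :
    f ∈ toricBoundaryIdeal K P ↔
      ∀ u : latticeMonoid P, u.1 ∉ interiorLattice P → (toricMap K P f).coeff u = 0 :=
  mem_interiorIdeal

theorem toricIdeal_le_toricBoundaryIdeal : toricIdeal K P ≤ toricBoundaryIdeal K P := by
  intro f hf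
  rw [mem_toricBoundaryIdeal, (RingHom.mem_ker).1 hf]
  intro u _
  simp

theorem monomial_mem_toricBoundaryIdeal {c : latticePoints P →₀ ℕ}
    (hc : gammaExp c ∈ interiorLattice P) (k : K) : monomial c k ∈ toricBoundaryIdeal K P := by
  classical
  rw [mem_toricBoundaryIdeal]
  intro u hu
  rw [toricMap_monomial, AddMonoidAlgebra.coeff_single, Finsupp.single_apply, if_neg]
  rintro rfl
  exact hu hc

theorem monomial_mem_interiorMonomialIdeal {c : latticePoints P →₀ ℕ}
    (hc : gammaExp c ∈ interiorLattice P) (k : K) : monomial c k ∈ interiorMonomialIdeal K P := by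
  have h : monomial c k = C k * monomial c (1 : K) := by rw [C_mul_monomial, mul_one]
  rw [h]
  exact Ideal.mul_mem_left _ _ (Ideal.subset_span ⟨c, hc, rfl⟩)

variable (K P) in
-- Let $f_2$ collect the terms of $f$ not over the interior. Its image has no coefficients in
-- $S_P^\circ$ by construction and none outside because $f_2$ lies in the ideal, so $f_2\in I_P$.
theorem toricBoundaryIdeal_eq_sup :
    toricBoundaryIdeal K P = toricIdeal K P ⊔ interiorMonomialIdeal K P := by
  classical
  apply le_antisymm
  · intro f hf
    set f₁ := ∑ c ∈ f.support with gammaExp c ∈ interiorLattice P, monomial c (coeff c f) with hf₁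
    set f₂ := ∑ c ∈ f.support with ¬ gammaExp c ∈ interiorLattice P, monomial c (coeff c f) with hf₂
    have hsum : f = f₂ + f₁ := by
      rw [add_comm, hf₁, hf₂, Finset.sum_filter_add_sum_filter_not]
      exact f.as_sum
    have h₁ : f₁ ∈ toricBoundaryIdeal K P := Ideal.sum_mem _ fun c hc =>
      monomial_mem_toricBoundaryIdeal (Finset.mem_filter.1 hc).2 _
    have h₂ : f₂ ∈ toricBoundaryIdeal K P := by
      have := sub_mem hf h₁
      rwa [hsum, add_sub_cancel_right] at this
    rw [hsum]
    refine Submodule.add_mem_sup ?_ (Ideal.sum_mem _ fun c hc =>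
      monomial_mem_interiorMonomialIdeal (Finset.mem_filter.1 hc).2 _)
    rw [toricIdeal, RingHom.mem_ker, ← AddMonoidAlgebra.coeff_eq_zero]
    ext u
    by_cases hu : u.1 ∈ interiorLattice P
    · rw [hf₂, map_sum, AddMonoidAlgebra.coeff_sum, Finsupp.finsetSum_apply, Finsupp.zero_apply]
      refine Finset.sum_eq_zero fun c hc => ?_
      rw [toricMap_monomial, AddMonoidAlgebra.coeff_single, Finsupp.single_apply, if_neg]
      rintro rfl
      exact (Finset.mem_filter.1 hc).2 hu
    · exact mem_toricBoundaryIdeal.1 h₂ u hu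
  · refine sup_le toricIdeal_le_toricBoundaryIdeal ?_
    rw [interiorMonomialIdeal, Ideal.span_le]
    rintro _ ⟨c, hc, rfl⟩
    exact monomial_mem_toricBoundaryIdeal hc 1

/-- The exponents of the monomials in the initial ideal of the toric boundary ideal: those that lie
over the interior of the cone, or that are not minimal in their fibre. -/
def nonstandard (P : Set (Fin d → ℝ)) (m : MonomialOrder (latticePoints P)) :
    Set (latticePoints P →₀ ℕ) :=
  {c | gammaExp c ∈ interiorLattice P ∨
    ∃ b, gammaExp b = gammaExp c ∧ m.toSyn b < m.toSyn c}

theorem isUpperSet_nonstandard (m : MonomialOrder (latticePoints P)) :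
    IsUpperSet (nonstandard P m) := by
  intro b c hbc hb
  obtain ⟨e, rfl⟩ := exists_add_of_le hbc
  rcases hb with hb | ⟨b', h1, h2⟩
  · left
    rw [gammaExp_add]
    exact interiorLattice_add hb (gammaExp_mem e)
  · right
    refine ⟨b' + e, by rw [gammaExp_add, gammaExp_add, h1], ?_⟩
    rw [map_add, map_add]
    exact add_lt_add_left h2 _

/-- A leading term over a boundary degree must cancel under $\varphi_P$ against another, hence
smaller, term of the same fibre. Conversely, monomials over the interior and binomials $x^c-x^b$
within a fibre realise all the listed exponents. -/
theorem initialIdeal_toricBoundaryIdeal (m : MonomialOrder (latticePoints P)) :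
    initialIdeal m (toricBoundaryIdeal K P) =
      Ideal.span ((fun c => monomial c (1 : K)) '' nonstandard P m) := by
  classical
  have hmon : ∀ e : latticePoints P →₀ ℕ, m.degree (monomial e (1 : K)) = e := fun e => by
    rw [MonomialOrder.degree_monomial, if_neg one_ne_zero]
  rw [initialIdeal]
  congr 1
  ext g
  constructor
  · rintro ⟨f, hf, hf0, rfl⟩
    refine ⟨m.degree f, ?_, rfl⟩
    by_contra hcon
    rw [nonstandard, Set.mem_ofPred_eq, not_or] at hcon
    have h0 := mem_toricBoundaryIdeal.1 hf (gammaElem (m.degree f)) hcon.1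
    rw [coeff_toricMap, Finset.sum_eq_single (m.degree f)] at h0
    · exact mem_support_iff.1 (MonomialOrder.degree_mem_support hf0) h0
    · intro b hb hne
      rw [Finset.mem_filter, gammaElem_eq_iff] at hb
      refine absurd ⟨b, hb.2, ?_⟩ hcon.2
      exact lt_of_le_of_ne (MonomialOrder.le_degree hb.1) fun h => hne (m.toSyn.injective h)
    · intro h
      refine absurd ?_ h
      rw [Finset.mem_filter]
      exact ⟨MonomialOrder.degree_mem_support hf0, rfl⟩
  · rintro ⟨c, hc | ⟨b, h1, h2⟩, rfl⟩
    · refine ⟨monomial c 1, monomial_mem_toricBoundaryIdeal hc 1, by simp, ?_⟩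
      rw [hmon]
    · have hdeg : m.degree (monomial c (1 : K) - monomial b 1) = c := by
        rw [MonomialOrder.degree_sub_of_lt (by rwa [hmon, hmon]), hmon]
      refine ⟨monomial c 1 - monomial b 1, toricIdeal_le_toricBoundaryIdeal ?_, ?_, by rw [hdeg]⟩
      · rw [toricIdeal, RingHom.mem_ker, map_sub, toricMap_monomial, toricMap_monomial,
          gammaElem_eq_iff.2 h1, sub_self]
      · intro h
        rw [sub_eq_zero] at h
        have := monomial_left_injective (one_ne_zero (α := K)) h
        rw [this] at h2
        exact lt_irrefl _ h2

end Toric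

/-! ### Facets -/

/-- A supporting hyperplane is rotated until it meets the cone in a facet: among the nonzero
nonnegative functionals vanishing on $T$, one whose zeros span a subspace of maximal dimension has
zeros spanning a hyperplane. -/
theorem exists_facet_functional {E ι : Type*} [AddCommGroup E] [Module ℝ E] [FiniteDimensional ℝ E]
    [Finite ι] (v : ι → E) (hv : ∀ L : Module.Dual ℝ E, (∀ i, L (v i) = 0) → L = 0) (T : Set ι)
    (L₀ : Module.Dual ℝ E) (h₀ : L₀ ≠ 0) (hnonneg : ∀ i, 0 ≤ L₀ (v i)) (hT : ∀ i ∈ T, L₀ (v i) = 0) :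
    ∃ L : Module.Dual ℝ E, L ≠ 0 ∧ (∀ i, 0 ≤ L (v i)) ∧ (∀ i ∈ T, L (v i) = 0) ∧
      Module.finrank ℝ (Submodule.span ℝ (v '' {i | L (v i) = 0})) + 1 = Module.finrank ℝ E := by
  set Z : Module.Dual ℝ E → Submodule ℝ E := fun L => Submodule.span ℝ (v '' {i | L (v i) = 0})
    with hZ
  obtain ⟨L, ⟨hL0, hLn, hLT⟩, hmax⟩ :=
    (measure fun L => Module.finrank ℝ E - Module.finrank ℝ (Z L)).wf.has_min
      {L : Module.Dual ℝ E | L ≠ 0 ∧ (∀ i, 0 ≤ L (v i)) ∧ ∀ i ∈ T, L (v i) = 0}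
      ⟨L₀, h₀, hnonneg, hT⟩
  refine ⟨L, hL0, hLn, hLT, ?_⟩
  have hker : Z L ≤ LinearMap.ker L := by
    rw [hZ, Submodule.span_le]
    rintro _ ⟨i, hi, rfl⟩
    exact hi
  have hle : Module.finrank ℝ (Z L) + 1 ≤ Module.finrank ℝ E := by
    rw [← Module.Dual.finrank_ker_add_one_of_ne_zero hL0]
    exact Nat.add_le_add_right (Submodule.finrank_mono hker) 1
  by_contra hne
  have hlt : Module.finrank ℝ (Z L) + 1 < Module.finrank ℝ E := lt_of_le_of_ne hle hne
  -- If the zeros of $L$ span too little, their annihilator has dimension at least two and offers a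
  -- direction of rotation.
  obtain ⟨L', hL'Z, hL'L⟩ : ∃ L' ∈ (Z L).dualAnnihilator, L' ∉ Submodule.span ℝ {L} := by
    by_contra hcon
    push Not at hcon
    have h1 : Module.finrank ℝ (Z L).dualAnnihilator ≤ 1 :=
      (Submodule.finrank_mono (show (Z L).dualAnnihilator ≤ Submodule.span ℝ {L} from hcon)).trans
        (finrank_span_singleton hL0).le
    have h2 := Subspace.finrank_add_finrank_dualAnnihilator_eq (Z L)
    omega
  have hL'0 : ∀ i, L (v i) = 0 → L' (v i) = 0 := fun i hi =>
    (Submodule.mem_dualAnnihilator _).1 hL'Z _ (Submodule.subset_span ⟨i, hi, rfl⟩)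
  obtain ⟨L', hL'0, hL'L, i₀, hi₀⟩ : ∃ L' : Module.Dual ℝ E,
      (∀ i, L (v i) = 0 → L' (v i) = 0) ∧ L' ∉ Submodule.span ℝ {L} ∧ ∃ i, L' (v i) < 0 := by
    by_cases h : ∃ i, L' (v i) < 0
    · exact ⟨L', hL'0, hL'L, h⟩
    · push Not at h
      refine ⟨-L', fun i hi => by simp [hL'0 i hi], fun hm => hL'L (by simpa using neg_mem hm), ?_⟩
      by_contra hcon
      push Not at hcon
      have : L' = 0 := hv L' fun i => le_antisymm (by simpa using hcon i) (h i)
      exact hL'L (this ▸ zero_mem _)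
  -- Ratio test: $t$ is the largest step for which $L+tL'$ stays nonnegative; it acquires the new
  -- zero $v_j$.
  obtain ⟨j, hj, hjmin⟩ := Set.exists_min_image {i | L' (v i) < 0}
    (fun i => L (v i) / (-L' (v i))) (Set.toFinite _) ⟨i₀, hi₀⟩
  set t := L (v j) / (-L' (v j)) with ht
  have hjpos : 0 < L (v j) := lt_of_le_of_ne (hLn j) fun h => by
    rw [Set.mem_ofPred_eq, hL'0 j h.symm] at hj
    exact lt_irrefl _ hj
  have hj' : 0 < -L' (v j) := by simpa using hj
  have htpos : 0 < t := div_pos hjpos hj'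
  have hMj : (L + t • L') (v j) = 0 := by
    rw [LinearMap.add_apply, LinearMap.smul_apply, smul_eq_mul, ht, div_neg, neg_mul,
      div_mul_cancel₀ _ (neg_pos.1 hj').ne, add_neg_cancel]
  have hM0 : L + t • L' ≠ 0 := by
    intro h
    apply hL'L
    rw [Submodule.mem_span_singleton]
    refine ⟨-t⁻¹, ?_⟩
    have : L = -(t • L') := eq_neg_of_add_eq_zero_left h
    rw [this, smul_neg, neg_smul, neg_neg, smul_smul, inv_mul_cancel₀ htpos.ne', one_smul]
  have hMz : ∀ i, L (v i) = 0 → (L + t • L') (v i) = 0 := fun i hi => by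
    simp [hi, hL'0 i hi]
  have hMn : ∀ i, 0 ≤ (L + t • L') (v i) := by
    intro i
    simp only [LinearMap.add_apply, LinearMap.smul_apply, smul_eq_mul]
    rcases lt_or_ge (L' (v i)) 0 with h | h
    · have h1 := hjmin i h
      rw [le_div_iff₀ (by linarith)] at h1
      linarith
    · exact add_nonneg (hLn i) (mul_nonneg htpos.le h)
  have hlt' : Z L < Z (L + t • L') := by
    refine lt_of_le_of_ne ?_ fun h => ?_
    · exact Submodule.span_mono (Set.image_mono fun i hi => hMz i hi)
    · have h1 : v j ∈ Z (L + t • L') := Submodule.subset_span ⟨j, hMj, rfl⟩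
      rw [← h] at h1
      exact hjpos.ne' (hker h1)
  have h1 := Submodule.finrank_lt_finrank_of_lt hlt'
  refine hmax (L + t • L') ⟨hM0, hMn, fun i hi => hMz i (hLT i hi)⟩ ?_
  change Module.finrank ℝ E - Module.finrank ℝ (Z (L + t • L')) <
    Module.finrank ℝ E - Module.finrank ℝ (Z L)
  omega

/-! ### Supporting functionals of the cone over the polytope -/

section Polytope

variable {d : ℕ} {P F : Set (Fin d → ℝ)}

theorem IsLatticeDPolytope.finite_latticePoints (hP : IsLatticeDPolytope P) :
    Finite (latticePoints P) := by
  obtain ⟨V, hV⟩ := hP.eq_convexHull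
  obtain ⟨u, hu⟩ := V.finite_toSet.bddAbove
  obtain ⟨l, hl⟩ := V.finite_toSet.bddBelow
  have hsub : P ⊆ Set.Icc (toReal l) (toReal u) := by
    rw [hV]
    refine convexHull_min ?_ (convex_Icc _ _)
    rintro _ ⟨a, ha, rfl⟩
    exact ⟨fun i => Int.cast_le.2 (hl ha i), fun i => Int.cast_le.2 (hu ha i)⟩
  refine ((Set.finite_Icc l u).subset fun a ha => ?_ : (latticePoints P).Finite).to_subtype
  have := hsub ha
  exact ⟨fun i => Int.cast_le.1 (this.1 i), fun i => Int.cast_le.1 (this.2 i)⟩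

theorem IsLatticeDPolytope.eq_convexHull_latticePoints (hP : IsLatticeDPolytope P) :
    P = convexHull ℝ (toReal '' latticePoints P) := by
  obtain ⟨V, hV⟩ := hP.eq_convexHull
  have hconv : Convex ℝ P := hV ▸ convex_convexHull ℝ _
  apply subset_antisymm
  · conv_lhs => rw [hV]
    refine convexHull_mono (Set.image_mono fun a ha => ?_)
    change toReal a ∈ P
    rw [hV]
    exact subset_convexHull ℝ _ ⟨a, ha, rfl⟩
  · refine convexHull_min ?_ hconv
    rintro _ ⟨a, ha, rfl⟩
    exact ha

/-- Full dimensionality on the level of the cone: the lifted lattice points span $\mathbb{R}^{d+1}$.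
-/
theorem IsLatticeDPolytope.dual_eq_zero (hP : IsLatticeDPolytope P)
    (L : Module.Dual ℝ ((Fin d → ℝ) × ℝ)) (hL : ∀ a : latticePoints P, L (toReal a.1, 1) = 0) :
    L = 0 := by
  have hspan : affineSpan ℝ (toReal '' latticePoints P) = ⊤ := by
    rw [← affineSpan_convexHull, ← hP.eq_convexHull_latticePoints, hP.fullDim]
  have h1 : ∀ x : Fin d → ℝ, L (x, 1) = 0 := by
    intro x
    have hx : x ∈ affineSpan ℝ (toReal '' latticePoints P) := by rw [hspan]; trivial
    refine affineSpan_induction (p := fun x => L (x, 1) = 0) hx ?_ ?_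
    · rintro _ ⟨a, ha, rfl⟩
      exact hL ⟨a, ha⟩
    · intro c u v w hu hv hw
      have : ((c • (u -ᵥ v) +ᵥ w, 1) : (Fin d → ℝ) × ℝ) =
          c • ((u, 1) - (v, 1)) + (w, 1) := by
        ext <;> simp
      rw [this, map_add, map_smul, map_sub, hu, hv, hw]
      simp
  refine LinearMap.ext fun ⟨x, t⟩ => ?_
  have : ((x, t) : (Fin d → ℝ) × ℝ) = (x, 1) - (0, 1) + t • (0, 1) := by ext <;> simp
  rw [this, map_add, map_sub, map_smul, h1, h1]
  simp

theorem nonneg_of_mem_coneOver (L : Module.Dual ℝ ((Fin d → ℝ) × ℝ))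
    (hL : ∀ x ∈ P, 0 ≤ L (x, 1)) {u : (Fin d → ℝ) × ℝ} (hu : u ∈ coneOver P) : 0 ≤ L u := by
  refine Submodule.span_induction (p := fun u _ => 0 ≤ L u) ?_ ?_ ?_ ?_ hu
  · rintro ⟨x, t⟩ ⟨hx, rfl⟩
    exact hL x hx
  · simp
  · intro x y _ _ hx hy
    rw [map_add]
    exact add_nonneg hx hy
  · intro c x _ hx
    have : c • x = (c : ℝ) • x := rfl
    rw [this, map_smul]
    exact mul_nonneg c.2 hx

/-- A nonzero functional is an open map, so it sends the interior of the cone into the interior of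
$[0,\infty)$. -/
theorem pos_of_mem_interior (L : Module.Dual ℝ ((Fin d → ℝ) × ℝ)) (hL0 : L ≠ 0)
    (hL : ∀ x ∈ P, 0 ≤ L (x, 1)) {u : (Fin d → ℝ) × ℝ}
    (hu : u ∈ interior (coneOver P : Set ((Fin d → ℝ) × ℝ))) : 0 < L u := by
  have hopen : IsOpenMap L := L.isOpenMap_of_finiteDimensional (LinearMap.surjective hL0)
  have h1 : L u ∈ interior (L '' (coneOver P : Set ((Fin d → ℝ) × ℝ))) :=
    hopen.image_interior_subset _ ⟨u, hu, rfl⟩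
  have h2 : L '' (coneOver P : Set ((Fin d → ℝ) × ℝ)) ⊆ Set.Ici 0 := by
    rintro _ ⟨x, hx, rfl⟩
    exact nonneg_of_mem_coneOver L hL hx
  have := interior_mono h2 h1
  rwa [interior_Ici] at this

theorem map_toRealProd_gammaExp (L : Module.Dual ℝ ((Fin d → ℝ) × ℝ)) (c : latticePoints P →₀ ℕ) :
    L (toRealProd (gammaExp c)) = c.sum fun a n => (n : ℝ) * L (toReal a.1, 1) := by
  induction c using Finsupp.induction_linear with
  | zero =>
    have : toRealProd (0 : (Fin d → ℤ) × ℤ) = 0 := by ext <;> simp [toRealProd, toReal]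
    rw [gammaExp_zero, this, map_zero, Finsupp.sum_zero_index]
  | add b c hb hc =>
    rw [gammaExp_add, toRealProd_add, map_add, hb, hc, Finsupp.sum_add_index' (by simp)]
    intro a n k
    push_cast
    ring
  | single a n =>
    have : toRealProd ((a.1, 1) : (Fin d → ℤ) × ℤ) = (toReal a.1, 1) := by simp [toRealProd]
    rw [gammaExp_single, toRealProd_nsmul, map_smul, this, Finsupp.sum_single_index (by simp)]
    rfl

theorem eq_zero_on_support (L : Module.Dual ℝ ((Fin d → ℝ) × ℝ))
    (hL : ∀ a : latticePoints P, 0 ≤ L (toReal a.1, 1)) {c : latticePoints P →₀ ℕ}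
    (h : L (toRealProd (gammaExp c)) = 0) : ∀ a ∈ c.support, L (toReal a.1, 1) = 0 := by
  rw [map_toRealProd_gammaExp, Finsupp.sum,
    Finset.sum_eq_zero_iff_of_nonneg fun a _ => mul_nonneg (Nat.cast_nonneg _) (hL a)] at h
  intro a ha
  have := h a ha
  rw [mul_eq_zero, Nat.cast_eq_zero] at this
  exact this.resolve_left (Finsupp.mem_support_iff.1 ha)

theorem zero_notMem_interiorLattice : (0 : (Fin d → ℤ) × ℤ) ∉ interiorLattice P := by
  intro h
  have := pos_of_mem_interior (P := P) (LinearMap.snd ℝ (Fin d → ℝ) ℝ) (fun h => by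
    have := LinearMap.congr_fun h (0, 1)
    simp at this) (fun x _ => by simp) h
  simp [toRealProd] at this

/-- Homogenise the functional $l$ exposing $F$ to $L(x,t)=t\max_P l-l(x)$. It is nonzero, since
otherwise $F=P$ would have dimension $d$. -/
theorem IsFacet.exists_functional (hP : IsLatticeDPolytope P) (hF : IsFacet P F) :
    ∃ L : Module.Dual ℝ ((Fin d → ℝ) × ℝ), L ≠ 0 ∧ (∀ x ∈ P, 0 ≤ L (x, 1)) ∧
      ∀ x ∈ P, L (x, 1) = 0 ↔ x ∈ F := by
  obtain ⟨l, hl⟩ := hF.isExposed hF.nonempty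
  obtain ⟨x₀, hx₀⟩ := hF.nonempty
  have hx₀' := hx₀
  rw [hl] at hx₀'
  set L : Module.Dual ℝ ((Fin d → ℝ) × ℝ) :=
    l x₀ • LinearMap.snd ℝ (Fin d → ℝ) ℝ - l.toLinearMap.comp (LinearMap.fst ℝ (Fin d → ℝ) ℝ)
  have hL : ∀ x, L (x, 1) = l x₀ - l x := by intro x; simp [L]
  have hLF : ∀ x ∈ P, L (x, 1) = 0 ↔ x ∈ F := by
    intro x hx
    rw [hL, hl]
    constructor
    · intro h
      exact ⟨hx, fun y hy => (hx₀'.2 y hy).trans (by linarith)⟩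
    · intro h
      exact sub_eq_zero.2 (le_antisymm (h.2 x₀ hx₀'.1) (hx₀'.2 x hx))
  refine ⟨L, fun h => ?_, fun x hx => ?_, hLF⟩
  · have hFP : F = P := subset_antisymm hF.isExposed.subset fun x hx =>
      (hLF x hx).1 (by rw [h]; rfl)
    have h1 := hF.finrank_add_one
    have h2 : vectorSpan ℝ P = ⊤ := by
      rw [← direction_affineSpan, hP.fullDim, AffineSubspace.direction_top]
    rw [hFP, h2, finrank_top, Module.finrank_fin_fun] at h1
    omega
  · rw [hL]
    exact sub_nonneg.2 (hx₀'.2 x hx)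

theorem IsFacet.gammaExp_notMem_interiorLattice (hP : IsLatticeDPolytope P) (hF : IsFacet P F)
    {c : latticePoints P →₀ ℕ} (hc : ∀ a ∈ c.support, toReal a.1 ∈ F) :
    gammaExp c ∉ interiorLattice P := by
  obtain ⟨L, hL0, hLn, hLF⟩ := hF.exists_functional hP
  intro h
  have h1 := pos_of_mem_interior L hL0 hLn h
  rw [map_toRealProd_gammaExp, Finsupp.sum, Finset.sum_eq_zero] at h1
  · exact lt_irrefl _ h1
  · intro a ha
    rw [(hLF _ a.2).2 (hc a ha), mul_zero]

/-- The functional of $F$ vanishes at $\gamma(c)=\gamma(b)$, where it is a sum of nonnegative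
contributions of the points in the support of $b$. -/
theorem IsFacet.support_subset (hP : IsLatticeDPolytope P) (hF : IsFacet P F)
    {b c : latticePoints P →₀ ℕ} (hbc : gammaExp b = gammaExp c)
    (hc : ∀ a ∈ c.support, toReal a.1 ∈ F) : ∀ a ∈ b.support, toReal a.1 ∈ F := by
  obtain ⟨L, hL0, hLn, hLF⟩ := hF.exists_functional hP
  have h0 : L (toRealProd (gammaExp b)) = 0 := by
    rw [hbc, map_toRealProd_gammaExp, Finsupp.sum, Finset.sum_eq_zero]
    intro a ha
    rw [(hLF _ a.2).2 (hc a ha), mul_zero]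
  intro a ha
  exact (hLF _ a.2).1 (eq_zero_on_support L (fun a => hLn _ a.2) h0 a ha)

theorem IsLatticeDPolytope.interior_coneOver_nonempty (hP : IsLatticeDPolytope P) :
    (interior (coneOver P : Set ((Fin d → ℝ) × ℝ))).Nonempty := by
  have hconv : Convex ℝ (coneOver P : Set ((Fin d → ℝ) × ℝ)) := (coneOver P).convex
  rw [hconv.interior_nonempty_iff_affineSpan_eq_top,
    AffineSubspace.affineSpan_eq_top_iff_vectorSpan_eq_top_of_nonempty _ _ _
      ⟨0, zero_mem (coneOver P)⟩]
  by_contra hne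
  obtain ⟨L, hL0, hL⟩ := Submodule.exists_le_ker_of_lt_top _ (lt_top_iff_ne_top.2 hne)
  refine hL0 (hP.dual_eq_zero L fun a => ?_)
  have h1 : ((toReal a.1, 1) : (Fin d → ℝ) × ℝ) ∈ coneOver P :=
    PointedCone.subset_hull ⟨a.2, rfl⟩
  have h2 := vsub_mem_vectorSpan ℝ (s := (coneOver P : Set ((Fin d → ℝ) × ℝ))) h1
    (zero_mem (coneOver P))
  rw [vsub_eq_sub, sub_zero] at h2
  exact hL h2

theorem IsLatticeDPolytope.exists_supporting (hP : IsLatticeDPolytope P) {u : (Fin d → ℝ) × ℝ}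
    (hu : u ∈ coneOver P) (hu' : u ∉ interior (coneOver P : Set ((Fin d → ℝ) × ℝ))) :
    ∃ L : Module.Dual ℝ ((Fin d → ℝ) × ℝ), L ≠ 0 ∧ (∀ x ∈ P, 0 ≤ L (x, 1)) ∧ L u = 0 := by
  have hconv : Convex ℝ (coneOver P : Set ((Fin d → ℝ) × ℝ)) := (coneOver P).convex
  obtain ⟨f, hf⟩ := geometric_hahn_banach_open_point hconv.interior isOpen_interior hu'
  obtain ⟨z, hz⟩ := hP.interior_coneOver_nonempty
  have hle : ∀ x ∈ coneOver P, f x ≤ f u := by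
    intro x hx
    have h1 : x ∈ closure (interior (coneOver P : Set ((Fin d → ℝ) × ℝ))) := by
      rw [hconv.closure_interior_eq_closure_of_nonempty_interior ⟨z, hz⟩]
      exact subset_closure hx
    exact closure_minimal (fun y hy => (hf y hy).le)
      (isClosed_le f.continuous continuous_const) h1
  -- Comparing $u$ with the points $0$ and $2u$ of the cone forces $f(u)=0$.
  have h0 : 0 ≤ f u := by simpa using hle 0 (zero_mem _)
  have h2 : f u ≤ 0 := by
    have := hle (u + u) (add_mem hu hu)
    rw [map_add] at this
    linarith
  have hfu : f u = 0 := le_antisymm h2 h0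
  refine ⟨-f.toLinearMap, fun h => ?_, fun x hx => ?_, by simp [hfu]⟩
  · have h1 := LinearMap.congr_fun h z
    have h3 := hf z hz
    simp at h1
    linarith
  · have := hle (x, 1) (PointedCone.subset_hull ⟨hx, rfl⟩)
    simp
    linarith

/-- A monomial that does not lie over the interior of the cone is supported on a facet. -/
theorem IsLatticeDPolytope.exists_facet (hP : IsLatticeDPolytope P) {c : latticePoints P →₀ ℕ}
    (hc0 : c ≠ 0) (hc : gammaExp c ∉ interiorLattice P) :
    ∃ F, IsFacet P F ∧ ∀ a ∈ c.support, toReal a.1 ∈ F := by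
  have := hP.finite_latticePoints
  obtain ⟨L₀, hL₀0, hL₀n, hL₀c⟩ := hP.exists_supporting (gammaExp_mem c) hc
  obtain ⟨L, hL0, hLn, hLc, hdim⟩ := exists_facet_functional
    (fun a : latticePoints P => ((toReal a.1, 1) : (Fin d → ℝ) × ℝ)) hP.dual_eq_zero
    (c.support : Set (latticePoints P)) L₀ hL₀0 (fun a => hL₀n _ a.2)
    (eq_zero_on_support L₀ (fun a => hL₀n _ a.2) hL₀c)
  have hLP : ∀ x ∈ P, 0 ≤ L (x, 1) := by
    intro x hx
    have hconv : Convex ℝ {x : Fin d → ℝ | 0 ≤ L (x, 1)} := by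
      intro x hx y hy s t hs ht hst
      have : ((s • x + t • y, 1) : (Fin d → ℝ) × ℝ) = s • (x, 1) + t • (y, 1) := by
        ext <;> simp [hst]
      rw [Set.mem_ofPred_eq, this, map_add, map_smul, map_smul]
      exact add_nonneg (mul_nonneg hs hx) (mul_nonneg ht hy)
    rw [hP.eq_convexHull_latticePoints] at hx
    refine convexHull_min ?_ hconv hx
    rintro _ ⟨a, ha, rfl⟩
    exact hLn ⟨a, ha⟩
  set F : Set (Fin d → ℝ) := {x ∈ P | L (x, 1) = 0} with hF
  have hLsub : ∀ x y : Fin d → ℝ, L (x, 1) - L (y, 1) = L (x - y, 0) := by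
    intro x y
    rw [← map_sub]
    simp
  obtain ⟨a₀, ha₀⟩ := Finsupp.support_nonempty_iff.2 hc0
  have ha₀F : toReal a₀.1 ∈ F := ⟨a₀.2, hLc a₀ ha₀⟩
  refine ⟨F, ⟨?_, ⟨_, ha₀F⟩, ?_⟩, fun a ha => ⟨a.2, hLc a ha⟩⟩
  · intro _
    refine ⟨LinearMap.toContinuousLinearMap (-(L.comp (LinearMap.inl ℝ (Fin d → ℝ) ℝ))), ?_⟩
    ext x
    have hval : ∀ y, (LinearMap.toContinuousLinearMap (-(L.comp (LinearMap.inl ℝ (Fin d → ℝ) ℝ)))) y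
        = - L (y, 0) := fun y => rfl
    have hval' : ∀ y, L (y, 1) = L (y, 0) + L (0, 1) := by
      intro y
      rw [← map_add]
      simp
    simp only [hF, Set.mem_ofPred_eq, hval]
    refine and_congr_right fun hx => ?_
    constructor
    · intro h y hy
      have := hLP y hy
      rw [hval'] at h this
      linarith
    · intro h
      have h1 := h _ a₀.2
      have h2 := hLc a₀ ha₀
      have h3 := hLP x hx
      rw [hval'] at h2 h3 ⊢
      linarith
  · rw [Module.finrank_prod, Module.finrank_fin_fun, Module.finrank_self] at hdim
    have hker : vectorSpan ℝ F ≤ LinearMap.ker (L.comp (LinearMap.inl ℝ (Fin d → ℝ) ℝ)) := by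
      rw [vectorSpan_def, Submodule.span_le]
      rintro _ ⟨x, hx, y, hy, rfl⟩
      change L (x - y, 0) = 0
      rw [← hLsub, hx.2, hy.2, sub_zero]
    have hne : L.comp (LinearMap.inl ℝ (Fin d → ℝ) ℝ) ≠ 0 := by
      intro h
      refine hL0 (hP.dual_eq_zero L fun a => ?_)
      have h1 := hLsub (toReal a.1) (toReal a₀.1)
      have h2 : L (toReal a.1 - toReal a₀.1, 0) = 0 := LinearMap.congr_fun h _
      rw [h2, ha₀F.2, sub_zero] at h1
      exact h1
    have hle : Module.finrank ℝ (vectorSpan ℝ F) + 1 ≤ d := by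
      have h1 := Module.Dual.finrank_ker_add_one_of_ne_zero
        (f := L.comp (LinearMap.inl ℝ (Fin d → ℝ) ℝ)) hne
      rw [Module.finrank_fin_fun] at h1
      have h2 := Submodule.finrank_mono hker
      omega
    refine le_antisymm hle ?_
    -- The lifted points of $F$ span a space of dimension $d$, contained in the direction of $F$
    -- plus one line; so the direction has dimension at least $d-1$.
    have hspan : Submodule.span ℝ ((fun a : latticePoints P =>
        ((toReal a.1, 1) : (Fin d → ℝ) × ℝ)) '' {a | L (toReal a.1, 1) = 0}) ≤
        (vectorSpan ℝ F).map (LinearMap.inl ℝ (Fin d → ℝ) ℝ) ⊔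
          Submodule.span ℝ {((toReal a₀.1, 1) : (Fin d → ℝ) × ℝ)} := by
      rw [Submodule.span_le]
      rintro _ ⟨a, ha, rfl⟩
      have h1 : ((toReal a.1, 1) : (Fin d → ℝ) × ℝ) =
          LinearMap.inl ℝ (Fin d → ℝ) ℝ (toReal a.1 - toReal a₀.1) + (toReal a₀.1, 1) := by
        simp
      simp only [SetLike.mem_coe]
      rw [h1]
      exact Submodule.add_mem_sup
        (Submodule.mem_map_of_mem (vsub_mem_vectorSpan ℝ (s := F) ⟨a.2, ha⟩ ha₀F))
        (Submodule.mem_span_singleton_self _)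
    have h1 := Submodule.finrank_mono hspan
    have h2 := Submodule.finrank_add_le_finrank_add_finrank
      ((vectorSpan ℝ F).map (LinearMap.inl ℝ (Fin d → ℝ) ℝ))
      (Submodule.span ℝ {((toReal a₀.1, 1) : (Fin d → ℝ) × ℝ)})
    have h3 := Submodule.finrank_map_le (LinearMap.inl ℝ (Fin d → ℝ) ℝ) (vectorSpan ℝ F)
    have h4 : Module.finrank ℝ (Submodule.span ℝ {((toReal a₀.1, 1) : (Fin d → ℝ) × ℝ)}) ≤ 1 := by
      rw [finrank_span_singleton]
      intro h
      simpa using congrArg Prod.snd h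
    omega

end Polytope

/-! ### Cells of facets -/

section Cells

variable {d : ℕ} {P F : Set (Fin d → ℝ)}

theorem gammaExp_fst_apply [Fintype (latticePoints P)] (c : latticePoints P →₀ ℕ) (i : Fin d) :
    (gammaExp c).1 i = ∑ a, (c a : ℤ) * a.1 i := by
  rw [gammaExp, Finsupp.sum_fintype _ _ (by simp), Prod.fst_sum, Finset.sum_apply]
  simp

theorem gammaExp_snd [Fintype (latticePoints P)] (c : latticePoints P →₀ ℕ) :
    (gammaExp c).2 = ∑ a, (c a : ℤ) := by
  rw [gammaExp, Finsupp.sum_fintype _ _ (by simp), Prod.snd_sum]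
  simp

theorem degree_eq_of_gammaExp_eq {b c : latticePoints P →₀ ℕ} (h : gammaExp b = gammaExp c) :
    b.degree = c.degree := by
  have key : ∀ c : latticePoints P →₀ ℕ, (gammaExp c).2 = c.degree := by
    intro c
    rw [gammaExp, Finsupp.sum, Prod.snd_sum, Finsupp.degree_apply]
    simp
  have := key b
  rw [h, key c] at this
  exact_mod_cast this.symm

theorem weight_eq_sum {ι : Type*} (ω : ι → ℝ) (c : ι →₀ ℕ) :
    Finsupp.weight ω c = c.sum fun a n => (n : ℝ) * ω a := by
  simp [Finsupp.weight_apply]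

/-- Farkas' lemma for affine functions, given as linear functions on the cone, with prescribed
upper bounds on `S` and lower bounds on `T`. -/
theorem exists_dual_or_certificate [Finite (latticePoints P)] (S T : Set (latticePoints P))
    (s t : latticePoints P → ℝ) :
    (∃ L : Module.Dual ℝ ((Fin d → ℝ) × ℝ), (∀ a ∈ S, L (toReal a.1, 1) ≤ s a) ∧
      ∀ a ∈ T, t a ≤ L (toReal a.1, 1)) ∨
    ∃ y z : latticePoints P →₀ ℕ, (∀ a ∈ y.support, a ∈ S) ∧ (∀ a ∈ z.support, a ∈ T) ∧
      gammaExp y = gammaExp z ∧ Finsupp.weight s y < Finsupp.weight t z := by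
  classical
  have := Fintype.ofFinite (latticePoints P)
  -- The coordinate `none` is the height. Points outside $S$ or $T$ contribute the trivial row $0\le
  -- 0$, whose multiplier is discarded below.
  let lift : latticePoints P → Option (Fin d) → ℤ := fun a k => k.elim 1 a.1
  by_cases h : ∃ x : Option (Fin d) → ℝ, ∀ i : latticePoints P ⊕ latticePoints P,
      ∑ k, ((i.elim (fun a => if a ∈ S then lift a else 0)
        (fun a => if a ∈ T then -lift a else 0) k : ℤ) : ℝ) * x k ≤
      i.elim (fun a => if a ∈ S then s a else 0) (fun a => if a ∈ T then -t a else 0)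
  · left
    obtain ⟨x, hx⟩ := h
    let L : Module.Dual ℝ ((Fin d → ℝ) × ℝ) :=
      (∑ i, x (some i) • (LinearMap.proj i).comp (LinearMap.fst ℝ (Fin d → ℝ) ℝ)) +
        x none • LinearMap.snd ℝ (Fin d → ℝ) ℝ
    have hL : ∀ a : latticePoints P, L (toReal a.1, 1) = ∑ k, (lift a k : ℝ) * x k := by
      intro a
      simp [L, lift, Fintype.sum_option, toReal, mul_comm, add_comm]
    refine ⟨L, fun a ha => ?_, fun a ha => ?_⟩
    · have := hx (Sum.inl a)
      simp only [Sum.elim_inl, if_pos ha] at this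
      rwa [hL]
    · have := hx (Sum.inr a)
      simp only [Sum.elim_inr, if_pos ha, Pi.neg_apply, Int.cast_neg, neg_mul,
        Finset.sum_neg_distrib] at this
      rw [hL]
      linarith
  · right
    obtain ⟨y, hy1, hy2⟩ := farkas _ _ h
    let y₁ : latticePoints P →₀ ℕ :=
      Finsupp.equivFunOnFinite.symm fun a => if a ∈ S then y (Sum.inl a) else 0
    let y₂ : latticePoints P →₀ ℕ :=
      Finsupp.equivFunOnFinite.symm fun a => if a ∈ T then y (Sum.inr a) else 0
    have hy₁ : ∀ a, y₁ a = if a ∈ S then y (Sum.inl a) else 0 := fun _ => rfl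
    have hy₂ : ∀ a, y₂ a = if a ∈ T then y (Sum.inr a) else 0 := fun _ => rfl
    have hrow : ∀ k, ∑ a, (y₁ a : ℤ) * lift a k = ∑ a, (y₂ a : ℤ) * lift a k := by
      intro k
      have := hy1 k
      rw [Fintype.sum_sum_type, ← eq_neg_iff_add_eq_zero, ← Finset.sum_neg_distrib] at this
      refine Eq.trans (Finset.sum_congr rfl fun a _ => ?_)
        (this.trans (Finset.sum_congr rfl fun a _ => ?_))
      · rw [hy₁]
        by_cases ha : a ∈ S <;> simp [ha]
      · rw [hy₂]
        by_cases ha : a ∈ T <;> simp [ha]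
    refine ⟨y₁, y₂, fun a ha => ?_, fun a ha => ?_, ?_, ?_⟩
    · by_contra hS
      simp [hy₁, hS] at ha
    · by_contra hT
      simp [hy₂, hT] at ha
    · ext i
      · rw [gammaExp_fst_apply, gammaExp_fst_apply]
        exact hrow (some i)
      · rw [gammaExp_snd, gammaExp_snd]
        simpa [lift] using hrow none
    · rw [Fintype.sum_sum_type] at hy2
      rw [weight_eq_sum, weight_eq_sum, Finsupp.sum_fintype _ _ (by simp),
        Finsupp.sum_fintype _ _ (by simp), ← sub_neg, sub_eq_add_neg, ← Finset.sum_neg_distrib]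
      refine lt_of_eq_of_lt (congrArg₂ _ (Finset.sum_congr rfl fun a _ => ?_)
        (Finset.sum_congr rfl fun a _ => ?_)) hy2
      · rw [hy₁]
        by_cases ha : a ∈ S <;> simp [ha]
      · rw [hy₂]
        by_cases ha : a ∈ T <;> simp [ha]

/-- `L`, restricted to height one, is an affine function witnessing that `σ` is a cell of the
regular subdivision of `F` induced by the weights `ω`. -/
structure IsCellWitness (F : Set (Fin d → ℝ)) (ω : latticePoints P → ℝ)
    (σ : Set (latticePoints P)) (L : Module.Dual ℝ ((Fin d → ℝ) × ℝ)) : Prop where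
  le : ∀ a : latticePoints P, toReal a.1 ∈ F → L (toReal a.1, 1) ≤ ω a
  mem_iff : ∀ a : latticePoints P, a ∈ σ ↔ toReal a.1 ∈ F ∧ L (toReal a.1, 1) = ω a

/-- Affine functions on $\mathbb{R}^d$ are linear functionals on $\mathbb{R}^{d+1}$ restricted to
height one. Cells thereby become sets of variables, and $L$ can be evaluated at $\gamma(c)$. -/
theorem mem_boundarySubdivision_iff {w : latticePoints (boundary P) → ℝ} {ω : latticePoints P → ℝ}
    (hω : ∀ b : latticePoints (boundary P),
      ω (Set.inclusion (latticePoints_mono (boundary_subset P)) b) = w b)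
    {τ : Set (Fin d → ℤ)} :
    τ ∈ boundarySubdivision P w ↔ ∃ F, IsFacet P F ∧ ∃ σ : Set (latticePoints P), σ.Nonempty ∧
      (∃ L, IsCellWitness F ω σ L) ∧ τ = Subtype.val '' σ := by
  constructor
  · rintro ⟨F, hF, hne, g, hg, rfl⟩
    have hFP : F ⊆ P := hF.isExposed.subset
    have hval : ∀ (a : latticePoints P) (ha : toReal a.1 ∈ F),
        ω a = w (Set.inclusion (latticePoints_mono hF.subset_boundary) ⟨a.1, ha⟩) :=
      fun a ha => hω ⟨a.1, hF.subset_boundary ha⟩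
    let L : Module.Dual ℝ ((Fin d → ℝ) × ℝ) :=
      g.linear.comp (LinearMap.fst ℝ (Fin d → ℝ) ℝ) + g 0 • LinearMap.snd ℝ (Fin d → ℝ) ℝ
    have hL : ∀ x, L (x, 1) = g x := by
      intro x
      have := g.map_vadd 0 x
      simp only [vadd_eq_add, add_zero] at this
      simp [L, this]
    have himg : {a | ∃ ha : a ∈ latticePoints F, g (toReal a) =
        w (Set.inclusion (latticePoints_mono hF.subset_boundary) ⟨a, ha⟩)} =
        Subtype.val '' {a : latticePoints P | toReal a.1 ∈ F ∧ L (toReal a.1, 1) = ω a} := by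
      ext a
      constructor
      · rintro ⟨ha, h⟩
        refine ⟨⟨a, hFP ha⟩, ⟨ha, ?_⟩, rfl⟩
        rw [hL, hval ⟨a, hFP ha⟩ ha, h]
      · rintro ⟨a, ⟨ha, h⟩, rfl⟩
        refine ⟨ha, ?_⟩
        rw [← hL, h, hval _ ha]
    refine ⟨F, hF, {a | toReal a.1 ∈ F ∧ L (toReal a.1, 1) = ω a}, ?_,
      ⟨L, fun a ha => ?_, fun a => Iff.rfl⟩, himg⟩
    · rw [himg] at hne
      exact hne.of_image
    · rw [hL, hval _ ha]
      exact hg ⟨a.1, ha⟩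
  · rintro ⟨F, hF, σ, hσ, ⟨L, hL⟩, rfl⟩
    have hFP : F ⊆ P := hF.isExposed.subset
    let g : (Fin d → ℝ) →ᵃ[ℝ] ℝ :=
      (L.comp (LinearMap.inl ℝ (Fin d → ℝ) ℝ)).toAffineMap + AffineMap.const ℝ _ (L (0, 1))
    have hg : ∀ x, g x = L (x, 1) := by
      intro x
      change L (x, 0) + L (0, 1) = L (x, 1)
      rw [← map_add]
      simp
    refine ⟨F, hF, hσ.image _, g, fun a => ?_, ?_⟩
    · rw [hg]
      exact (hL.le ⟨a.1, hFP a.2⟩ a.2).trans (hω ⟨a.1, hF.subset_boundary a.2⟩).le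
    · ext a
      constructor
      · rintro ⟨a, ha, rfl⟩
        obtain ⟨h1, h2⟩ := (hL.mem_iff a).1 ha
        refine ⟨h1, ?_⟩
        rw [hg, h2]
        exact hω ⟨a.1, hF.subset_boundary h1⟩
      · rintro ⟨ha, h⟩
        refine ⟨⟨a, hFP ha⟩, (hL.mem_iff _).2 ⟨ha, ?_⟩, rfl⟩
        rw [← hg, h]
        exact (hω ⟨a, hF.subset_boundary ha⟩).symm

section Witness

variable {ω : latticePoints P → ℝ} {σ : Set (latticePoints P)}
  {L : Module.Dual ℝ ((Fin d → ℝ) × ℝ)} {c : latticePoints P →₀ ℕ}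

/-- Weak duality: the left side depends only on the fibre of $c$, so it bounds from below the weight
of every monomial of the fibre supported on $F$. -/
theorem IsCellWitness.map_gammaExp_le (hL : IsCellWitness F ω σ L)
    (hc : ∀ a ∈ c.support, toReal a.1 ∈ F) :
    L (toRealProd (gammaExp c)) ≤ Finsupp.weight ω c := by
  rw [map_toRealProd_gammaExp, weight_eq_sum]
  exact Finset.sum_le_sum fun a ha =>
    mul_le_mul_of_nonneg_left (hL.le a (hc a ha)) (Nat.cast_nonneg _)

theorem IsCellWitness.map_gammaExp_eq (hL : IsCellWitness F ω σ L)
    (hc : ∀ a ∈ c.support, a ∈ σ) :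
    L (toRealProd (gammaExp c)) = Finsupp.weight ω c := by
  rw [map_toRealProd_gammaExp, weight_eq_sum]
  refine Finset.sum_congr rfl fun a ha => ?_
  exact congrArg (fun r => (c a : ℝ) * r) ((hL.mem_iff a).1 (hc a ha)).2

/-- Complementary slackness: equality in the weak duality bound forces equality in every term. -/
theorem IsCellWitness.support_subset (hL : IsCellWitness F ω σ L)
    (hc : ∀ a ∈ c.support, toReal a.1 ∈ F)
    (h : L (toRealProd (gammaExp c)) = Finsupp.weight ω c) : ∀ a ∈ c.support, a ∈ σ := by
  rw [map_toRealProd_gammaExp, weight_eq_sum, Finsupp.sum, Finsupp.sum,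
    Finset.sum_eq_sum_iff_of_le fun a ha =>
      mul_le_mul_of_nonneg_left (hL.le a (hc a ha)) (Nat.cast_nonneg _)] at h
  intro a ha
  refine (hL.mem_iff a).2 ⟨hc a ha, mul_left_cancel₀ ?_ (h a ha)⟩
  exact Nat.cast_ne_zero.2 (Finsupp.mem_support_iff.1 ha)

/-- Monomials supported on a cell without integral relations are the unique ones of minimal weight
in their fibre. -/
theorem IsCellWitness.weight_lt (hP : IsLatticeDPolytope P) (hF : IsFacet P F)
    (hL : IsCellWitness F ω σ L)
    (hσ : ∀ b c : latticePoints P →₀ ℕ, (∀ a ∈ b.support, a ∈ σ) → (∀ a ∈ c.support, a ∈ σ) →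
      gammaExp b = gammaExp c → b = c)
    (hc : ∀ a ∈ c.support, a ∈ σ) {b : latticePoints P →₀ ℕ} (hbc : gammaExp b = gammaExp c)
    (hne : b ≠ c) : Finsupp.weight ω c < Finsupp.weight ω b := by
  have hbF := hF.support_subset hP hbc fun a ha => ((hL.mem_iff a).1 (hc a ha)).1
  rw [← hL.map_gammaExp_eq hc, ← hbc]
  refine lt_of_le_of_ne (hL.map_gammaExp_le hbF) fun h => hne ?_
  exact hσ b c (hL.support_subset hbF h) hc hbc

end Witness

/-- The equation $\gamma(b)=\gamma(c)$ says that $b-c$ is an affine dependence: the last coordinate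
gives coefficient sum zero, the others give vanishing of the combination. -/
theorem eq_of_affineIndependent [Finite (latticePoints P)] {σ : Set (latticePoints P)}
    (hσ : AffineIndependent ℝ fun a : (Subtype.val '' σ : Set (Fin d → ℤ)) => toReal a.1)
    {b c : latticePoints P →₀ ℕ} (hb : ∀ a ∈ b.support, a ∈ σ) (hc : ∀ a ∈ c.support, a ∈ σ)
    (h : gammaExp b = gammaExp c) : b = c := by
  classical
  have := Fintype.ofFinite (latticePoints P)
  let e : σ → (Subtype.val '' σ : Set (Fin d → ℤ)) := fun a => ⟨a.1.1, a.1, a.2, rfl⟩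
  have he : Function.Injective e := by
    intro a a' haa
    have h1 : (e a).1 = (e a').1 := by rw [haa]
    exact Subtype.ext (Subtype.ext h1)
  have hσ' : AffineIndependent ℝ fun a : σ => toReal a.1.1 := hσ.comp_embedding ⟨e, he⟩
  rw [affineIndependent_iff] at hσ'
  have hout : ∀ a ∉ σ, b a = 0 ∧ c a = 0 := by
    intro a ha
    constructor
    · by_contra h0
      exact ha (hb a (Finsupp.mem_support_iff.2 h0))
    · by_contra h0
      exact ha (hc a (Finsupp.mem_support_iff.2 h0))
  have hsum : ∀ f : latticePoints P → ℝ,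
      ∑ a : σ, ((b a.1 : ℝ) - c a.1) * f a.1 = ∑ a, ((b a : ℝ) - c a) * f a := by
    intro f
    refine Finset.sum_of_injOn Subtype.val Subtype.val_injective.injOn (by simp) ?_ (by simp)
    intro a _ ha
    have : a ∉ σ := fun h => ha ⟨⟨a, h⟩, by simp, rfl⟩
    rw [(hout a this).1, (hout a this).2]
    simp
  have hzero : ∀ L : Module.Dual ℝ ((Fin d → ℝ) × ℝ),
      ∑ a, ((b a : ℝ) - c a) * L (toReal a.1, 1) = 0 := by
    intro L
    have h1 := map_toRealProd_gammaExp L b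
    rw [h, map_toRealProd_gammaExp, Finsupp.sum_fintype _ _ (by simp),
      Finsupp.sum_fintype _ _ (by simp)] at h1
    simp only [sub_mul, Finset.sum_sub_distrib, h1, sub_self]
  have key := hσ' Finset.univ (fun a => (b a.1 : ℝ) - c a.1) ?_ ?_
  · ext a
    by_cases ha : a ∈ σ
    · have := key ⟨a, ha⟩ (Finset.mem_univ _)
      exact_mod_cast sub_eq_zero.1 this
    · rw [(hout a ha).1, (hout a ha).2]
  · have h1 := hsum fun _ => 1
    have h2 := hzero (LinearMap.snd ℝ (Fin d → ℝ) ℝ)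
    simp only [mul_one] at h1
    rw [h1]
    simpa using h2
  · ext i
    have h1 := hsum fun a => toReal a.1 i
    have h2 := hzero ((LinearMap.proj i).comp (LinearMap.fst ℝ (Fin d → ℝ) ℝ))
    rw [Finset.sum_apply]
    exact h1.trans h2

/-- If no affine function below the weights on `F` is tight on `σ`, then some power of the
squarefree monomial on `σ` does not have minimal weight in its fibre. -/
theorem exists_dual_or_weight_lt [Finite (latticePoints P)] (ω : latticePoints P → ℝ)
    {σ : Finset (latticePoints P)} (hσ : ∀ a ∈ σ, toReal a.1 ∈ F) :
    (∃ L : Module.Dual ℝ ((Fin d → ℝ) × ℝ),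
      (∀ a : latticePoints P, toReal a.1 ∈ F → L (toReal a.1, 1) ≤ ω a) ∧
      ∀ a ∈ σ, L (toReal a.1, 1) = ω a) ∨
    ∃ (n : ℕ) (b : latticePoints P →₀ ℕ), gammaExp b = gammaExp (n • oneOn σ) ∧
      Finsupp.weight ω b < Finsupp.weight ω (n • oneOn σ) := by
  rcases exists_dual_or_certificate {a : latticePoints P | toReal a.1 ∈ F} (σ : Set _) ω ω with
    ⟨L, h1, h2⟩ | ⟨y, z, -, hz, hγ, hw⟩
  · exact Or.inl ⟨L, h1, fun a ha => le_antisymm (h1 a (hσ a ha)) (h2 a ha)⟩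
  · right
    -- The heavier side $z$ of the certificate is supported on $\sigma$, so it divides a power of
    -- $x^\sigma$; replacing the factor $z$ by $y$ lowers the weight within the fibre.
    obtain ⟨n, hn⟩ := exists_le_nsmul_oneOn (σ := σ) (c := z) hz
    obtain ⟨e, he⟩ := exists_add_of_le hn
    refine ⟨n, y + e, ?_, ?_⟩
    · rw [he, gammaExp_add, gammaExp_add, hγ]
    · rw [he, map_add, map_add]
      linarith

/-- A cell without integral relations is interpolated by affine functions. -/
theorem exists_dual_interpolating [Finite (latticePoints P)] {σ : Set (latticePoints P)}
    (hσ : ∀ b c : latticePoints P →₀ ℕ, (∀ a ∈ b.support, a ∈ σ) → (∀ a ∈ c.support, a ∈ σ) →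
      gammaExp b = gammaExp c → b = c) (v : latticePoints P → ℝ) :
    ∃ L : Module.Dual ℝ ((Fin d → ℝ) × ℝ), ∀ a ∈ σ, L (toReal a.1, 1) = v a := by
  -- With $v$ as both upper and lower bound, a certificate would be a relation between monomials on
  -- $\sigma$; relations are trivial and cannot change the weight.
  rcases exists_dual_or_certificate σ σ v v with ⟨L, h1, h2⟩ | ⟨y, z, hy, hz, hγ, hw⟩
  · exact ⟨L, fun a ha => le_antisymm (h1 a ha) (h2 a ha)⟩
  · rw [hσ y z hy hz hγ] at hw
    exact absurd hw (lt_irrefl _)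

/-- A functional that is $1$ at one point and $0$ at the others isolates that point's coefficient in
any affine dependence. -/
theorem affineIndependent_of_interpolating {σ : Set (latticePoints P)}
    (hσ : ∀ v : latticePoints P → ℝ,
      ∃ L : Module.Dual ℝ ((Fin d → ℝ) × ℝ), ∀ a ∈ σ, L (toReal a.1, 1) = v a) :
    AffineIndependent ℝ fun a : (Subtype.val '' σ : Set (Fin d → ℤ)) => toReal a.1 := by
  classical
  rw [affineIndependent_iff]
  intro s u hu1 hu2 e he
  obtain ⟨_, a₀, ha₀, rfl⟩ := e
  obtain ⟨L, hL⟩ := hσ (Pi.single a₀ 1)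
  have h0 : ∑ i ∈ s, u i • ((toReal i.1, 1) : (Fin d → ℝ) × ℝ) = 0 := by
    refine Prod.ext ?_ ?_
    · rw [Prod.fst_sum]; exact hu2
    · rw [Prod.snd_sum]; simpa using hu1
  have h1 := congrArg L h0
  rw [map_sum, map_zero, Finset.sum_eq_single_of_mem _ he] at h1
  · rw [map_smul, hL a₀ ha₀, Pi.single_eq_same, smul_eq_mul, mul_one] at h1
    exact h1
  · rintro ⟨_, a, ha, rfl⟩ _ hne
    rw [map_smul, hL a ha, Pi.single_eq_of_ne, smul_zero]
    rintro rfl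
    exact hne rfl

/-- Nonempty subsets of a simplicial cell are cells. -/
theorem IsCellWitness.exists_of_subset [Finite (latticePoints P)] {ω : latticePoints P → ℝ}
    {σ τ : Set (latticePoints P)} {L : Module.Dual ℝ ((Fin d → ℝ) × ℝ)}
    (hL : IsCellWitness F ω τ L)
    (hτ : ∀ v : latticePoints P → ℝ,
      ∃ L : Module.Dual ℝ ((Fin d → ℝ) × ℝ), ∀ a ∈ τ, L (toReal a.1, 1) = v a)
    (hσ : σ ⊆ τ) : ∃ L', IsCellWitness F ω σ L' := by
  classical
  -- Adding $\varepsilon H$ keeps $L$ tight on $\sigma$ and lowers it on $\tau\setminus\sigma$; for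
  -- small $\varepsilon>0$ the finitely many strict inequalities outside $\tau$ survive.
  obtain ⟨H, hH⟩ := hτ fun a => if a ∈ σ then 0 else -1
  obtain ⟨ε, hε, hε0⟩ : ∃ ε : ℝ, (∀ a : latticePoints P, toReal a.1 ∈ F → a ∉ τ →
      ε * H (toReal a.1, 1) < ω a - L (toReal a.1, 1)) ∧ 0 < ε := by
    have h1 : ∀ᶠ ε : ℝ in nhdsWithin 0 (Set.Ioi 0), ∀ a : latticePoints P, toReal a.1 ∈ F →
        a ∉ τ → ε * H (toReal a.1, 1) < ω a - L (toReal a.1, 1) := by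
      rw [Filter.eventually_all]
      intro a
      by_cases ha : toReal a.1 ∈ F ∧ a ∉ τ
      · have hpos : 0 * H (toReal a.1, 1) < ω a - L (toReal a.1, 1) := by
          rw [zero_mul, sub_pos]
          exact lt_of_le_of_ne (hL.le a ha.1) fun h => ha.2 ((hL.mem_iff a).2 ⟨ha.1, h⟩)
        have hcont : Continuous fun ε : ℝ => ε * H (toReal a.1, 1) := by fun_prop
        have := hcont.continuousAt.eventually_lt continuousAt_const hpos
        exact (this.filter_mono nhdsWithin_le_nhds).mono fun ε h _ _ => h
      · exact Filter.Eventually.of_forall fun ε h2 h3 => absurd ⟨h2, h3⟩ ha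
    obtain ⟨ε, h2, h3⟩ := (h1.and self_mem_nhdsWithin).exists
    exact ⟨ε, h2, h3⟩
  have happ : ∀ a : latticePoints P, (L + ε • H) (toReal a.1, 1) =
      L (toReal a.1, 1) + ε * H (toReal a.1, 1) := fun a => rfl
  have hlt : ∀ a : latticePoints P, toReal a.1 ∈ F → a ∉ σ →
      (L + ε • H) (toReal a.1, 1) < ω a := by
    intro a ha hσa
    rw [happ]
    by_cases hτa : a ∈ τ
    · have := hH a hτa
      rw [if_neg hσa] at this
      rw [this, ((hL.mem_iff a).1 hτa).2]
      linarith
    · have := hε a ha hτa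
      linarith
  have heq : ∀ a ∈ σ, (L + ε • H) (toReal a.1, 1) = ω a := by
    intro a ha
    have := hH a (hσ ha)
    rw [if_pos ha] at this
    rw [happ, this, ((hL.mem_iff a).1 (hσ ha)).2, mul_zero, add_zero]
  refine ⟨L + ε • H, fun a ha => ?_, fun a => ?_⟩
  · by_cases hσa : a ∈ σ
    · exact (heq a hσa).le
    · exact (hlt a ha hσa).le
  · constructor
    · exact fun ha => ⟨((hL.mem_iff a).1 (hσ ha)).1, heq a ha⟩
    · rintro ⟨h1, h2⟩
      by_contra hσa
      exact (hlt a h1 hσa).ne h2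

end Cells

/-! ### Initial complexes of the toric boundary ideal -/

section Main

variable {d : ℕ} {P F : Set (Fin d → ℝ)}

theorem isInitialComplex_iff {K : Type*} [Field K] (m : MonomialOrder (latticePoints P))
    (Δ : PreAbstractSimplicialComplex (latticePoints P)) :
    IsInitialComplex m (toricBoundaryIdeal K P) Δ ↔
      ∀ σ : Finset (latticePoints P), σ.Nonempty →
        (σ ∈ Δ.faces ↔ ∀ n : ℕ, n • oneOn σ ∉ nonstandard P m) := by
  rw [IsInitialComplex, initialIdeal_toricBoundaryIdeal]
  refine stanleyReisnerIdeal_eq_radical_iff (isUpperSet_nonstandard m) ?_ Δ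
  rintro (h | ⟨b, -, hb⟩)
  · rw [gammaExp_zero] at h
    exact zero_notMem_interiorLattice h
  · rw [map_zero] at hb
    exact absurd hb (m.zero_le _).not_gt

theorem exists_facet_of_notMem_nonstandard (hP : IsLatticeDPolytope P)
    {m : MonomialOrder (latticePoints P)} {σ : Finset (latticePoints P)} (hσ : σ.Nonempty)
    (h : ∀ n : ℕ, n • oneOn σ ∉ nonstandard P m) :
    ∃ F, IsFacet P F ∧ ∀ a ∈ σ, toReal a.1 ∈ F := by
  have h1 := h 1
  rw [one_smul] at h1
  have hne : oneOn σ ≠ 0 := by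
    rw [← Finsupp.support_nonempty_iff, support_oneOn]
    exact hσ
  have := hP.exists_facet hne fun hc => h1 (Or.inl hc)
  rwa [support_oneOn] at this

/-- On a simplicial cell, powers of $x^\sigma$ are the unique lightest monomials of their fibres,
hence standard. Conversely, if all powers are standard, then $\sigma$ lies in a facet and the Farkas
alternative leaves only an affine function tight on $\sigma$, so $\sigma$ is contained in a cell. -/
theorem isInitialComplex_of_inducesTriangulation {K : Type*} [Field K]
    (hP : IsLatticeDPolytope P) {Δ : PreAbstractSimplicialComplex (latticePoints P)}
    {w : latticePoints (boundary P) → ℝ} {ω : latticePoints P → ℝ}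
    {m : MonomialOrder (latticePoints P)} (hΔ : InducesTriangulation P w Δ)
    (hω : ∀ b : latticePoints (boundary P),
      ω (Set.inclusion (latticePoints_mono (boundary_subset P)) b) = w b)
    (hm : IsWeightOrder ω m) : IsInitialComplex m (toricBoundaryIdeal K P) Δ := by
  classical
  have := hP.finite_latticePoints
  have := Fintype.ofFinite (latticePoints P)
  rw [isInitialComplex_iff]
  intro σ hσ
  constructor
  · intro hσΔ n
    have hcell := (hΔ.mem_faces_iff σ).1 hσΔ
    have hind := hΔ.affineIndependent _ hcell
    obtain ⟨F, hF, σ', -, ⟨L, hL⟩, hσ'⟩ := (mem_boundarySubdivision_iff hω).1 hcell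
    obtain rfl : (σ : Set (latticePoints P)) = σ' :=
      Set.image_injective.2 Subtype.val_injective hσ'
    have hsupp : ∀ a ∈ (n • oneOn σ).support, a ∈ (σ : Set (latticePoints P)) := fun a ha =>
      mem_of_nsmul_oneOn_ne_zero (Finsupp.mem_support_iff.1 ha)
    rintro (h | ⟨b, hb, hlt⟩)
    · exact hF.gammaExp_notMem_interiorLattice hP
        (fun a ha => ((hL.mem_iff a).1 (hsupp a ha)).1) h
    · have hne : b ≠ n • oneOn σ := by
        rintro rfl
        exact lt_irrefl _ hlt
      have hw := hL.weight_lt hP hF (fun b c hb hc => eq_of_affineIndependent hind hb hc)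
        hsupp hb hne
      exact lt_asymm hlt (hm _ _ (degree_eq_of_gammaExp_eq hb).symm hw)
  · intro h
    obtain ⟨F, hF, hσF⟩ := exists_facet_of_notMem_nonstandard hP hσ h
    rcases exists_dual_or_weight_lt ω hσF with ⟨L, hLle, hLeq⟩ | ⟨n, b, hb, hw⟩
    · let τ : Finset (latticePoints P) :=
        {a | toReal a.1 ∈ F ∧ L (toReal a.1, 1) = ω a}
      have hστ : σ ⊆ τ := fun a ha => by
        simp only [τ, Finset.mem_filter, Finset.mem_univ, true_and]
        exact ⟨hσF a ha, hLeq a ha⟩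
      have hτ : τ ∈ Δ.faces := by
        rw [hΔ.mem_faces_iff, mem_boundarySubdivision_iff hω]
        refine ⟨F, hF, τ, (hσ.mono hστ), ⟨L, hLle, fun a => ?_⟩, rfl⟩
        simp [τ]
      exact (Δ.isRelLowerSet_faces hτ).2 hστ hσ
    · exact absurd (Or.inr ⟨b, hb, hm _ _ (degree_eq_of_gammaExp_eq hb) hw⟩) (h n)

/-- A finite set of strict comparisons in a term order is realised by weights. -/
theorem exists_weight_of_finite {ι : Type*} [Finite ι] (m : MonomialOrder ι) {G : Set (ι →₀ ℕ)}
    (hG : G.Finite) (β : (ι →₀ ℕ) → (ι →₀ ℕ)) (hβ : ∀ c ∈ G, m.toSyn (β c) < m.toSyn c) :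
    ∃ ω : ι → ℝ, ∀ c ∈ G, Finsupp.weight ω (β c) < Finsupp.weight ω c := by
  have := Fintype.ofFinite ι
  have := hG.fintype
  -- Finitely many strict inequalities can be scaled to have gap $1$. A Farkas certificate would
  -- multiply the comparisons to one between equal monomials, although at least one strict
  -- comparison enters.
  by_cases h : ∃ x : ι → ℝ, ∀ c : G, ∑ a, (((β c a : ℤ) - c.1 a : ℤ) : ℝ) * x a ≤ -1
  · obtain ⟨ω, hω⟩ := h
    refine ⟨ω, fun c hc => ?_⟩
    have h1 := hω ⟨c, hc⟩
    rw [weight_eq_sum, weight_eq_sum, Finsupp.sum_fintype _ _ (by simp),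
      Finsupp.sum_fintype _ _ (by simp)]
    simp only [Int.cast_sub, Int.cast_natCast, sub_mul, Finset.sum_sub_distrib] at h1
    linarith
  · obtain ⟨y, hy1, hy2⟩ := farkas _ _ h
    exfalso
    have heq : ∑ c : G, y c • β c = ∑ c : G, y c • c.1 := by
      ext a
      have := hy1 a
      simp only [mul_sub, Finset.sum_sub_distrib, sub_eq_zero] at this
      simp only [Finsupp.finsetSum_apply, Finsupp.smul_apply, smul_eq_mul]
      exact_mod_cast this
    obtain ⟨c₀, hc₀⟩ : ∃ c, y c ≠ 0 := by
      by_contra hcon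
      push Not at hcon
      simp [hcon] at hy2
    have hlt : ∑ c : G, y c • m.toSyn (β c) < ∑ c : G, y c • m.toSyn c.1 := by
      refine Finset.sum_lt_sum (fun c _ => nsmul_le_nsmul_right (hβ c c.2).le _)
        ⟨c₀, Finset.mem_univ _, nsmul_lt_nsmul_right hc₀ (hβ c₀ c₀.2)⟩
    have := congrArg m.toSyn heq
    simp only [map_sum, map_nsmul] at this
    exact hlt.ne this

/-- There are weights for which the standard monomials are the unique ones of minimal weight in
their fibres. -/
theorem exists_weight_of_monomialOrder [Finite (latticePoints P)]
    (m : MonomialOrder (latticePoints P)) :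
    ∃ ω : latticePoints P → ℝ, ∀ c ∉ nonstandard P m, ∀ b, gammaExp b = gammaExp c → b ≠ c →
      Finsupp.weight ω c < Finsupp.weight ω b := by
  set N : Set (latticePoints P →₀ ℕ) := {c | gammaExp c ∉ interiorLattice P ∧
    ∃ b, gammaExp b = gammaExp c ∧ m.toSyn b < m.toSyn c} with hN
  have hGfin : {c | Minimal (· ∈ N) c}.Finite :=
    WellQuasiOrderedLE.finite_of_isAntichain (setOfPred_minimal_antichain _)
  have hex : ∀ c : latticePoints P →₀ ℕ, ∃ b, c ∈ N →
      gammaExp b = gammaExp c ∧ m.toSyn b < m.toSyn c := by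
    intro c
    by_cases hc : c ∈ N
    · obtain ⟨b, hb⟩ := hc.2
      exact ⟨b, fun _ => hb⟩
    · exact ⟨0, fun h => absurd h hc⟩
  choose β hβ using hex
  obtain ⟨ω, hω⟩ := exists_weight_of_finite m hGfin β fun c hc => (hβ c hc.prop).2
  refine ⟨ω, fun c hc b => ?_⟩
  -- The comparison chosen for a minimal element of $N$ below $b$, translated by the quotient,
  -- lowers $b$ in both the term order and the weight.
  have hdesc : ∀ b ∈ N, ∃ b', gammaExp b' = gammaExp b ∧ m.toSyn b' < m.toSyn b ∧
      Finsupp.weight ω b' < Finsupp.weight ω b := by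
    intro b hb
    obtain ⟨b₀, hle, hmin⟩ := exists_minimal_le_of_wellFoundedLT (· ∈ N) b hb
    obtain ⟨e, rfl⟩ := exists_add_of_le hle
    obtain ⟨h1, h2⟩ := hβ b₀ hmin.prop
    refine ⟨β b₀ + e, by rw [gammaExp_add, gammaExp_add, h1], ?_, ?_⟩
    · rw [map_add, map_add]
      exact add_lt_add_left h2 _
    · rw [map_add, map_add]
      exact add_lt_add_left (hω b₀ hmin) _
  rw [nonstandard, Set.mem_ofPred_eq, not_or] at hc
  -- Well-founded induction along the term order: the descent can only end at $c$, the smallest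
  -- element of the fibre, and the weight drops at every step.
  suffices ∀ s : m.syn, ∀ b, m.toSyn b = s → gammaExp b = gammaExp c → b ≠ c →
      Finsupp.weight ω c < Finsupp.weight ω b from this _ b rfl
  intro s
  induction s using WellFoundedLT.induction with
  | ind s ih =>
    rintro b rfl hbc hne
    have hlt : m.toSyn c < m.toSyn b := by
      refine lt_of_le_of_ne (not_lt.1 fun h => hc.2 ⟨b, hbc, h⟩) fun h => ?_
      exact hne (m.toSyn.injective h).symm
    obtain ⟨b', h1, h2, h3⟩ := hdesc b ⟨by rw [hbc]; exact hc.1, c, hbc.symm, hlt⟩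
    rcases eq_or_ne b' c with rfl | hne'
    · exact h3
    · exact (ih _ h2 b' rfl (h1.trans hbc) hne').trans h3

theorem exists_standard_of_notMem_interiorLattice (m : MonomialOrder (latticePoints P))
    {c : latticePoints P →₀ ℕ} (hc : gammaExp c ∉ interiorLattice P) :
    ∃ c₀ ∉ nonstandard P m, gammaExp c₀ = gammaExp c := by
  obtain ⟨c₀, hc₀, hmin⟩ := (InvImage.wf m.toSyn (wellFounded_lt (α := m.syn))).has_min
    {b | gammaExp b = gammaExp c} ⟨c, rfl⟩
  refine ⟨c₀, ?_, hc₀⟩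
  rintro (h | ⟨b, hb, hlt⟩)
  · rw [hc₀] at h
    exact hc h
  · exact hmin b (hb.trans hc₀) hlt

theorem isRegularBoundaryTriangulation_of_isInitialComplex {K : Type*} [Field K]
    (hP : IsLatticeDPolytope P) {Δ : PreAbstractSimplicialComplex (latticePoints P)}
    {m : MonomialOrder (latticePoints P)} (hΔ : IsInitialComplex m (toricBoundaryIdeal K P) Δ) :
    IsRegularBoundaryTriangulation P Δ := by
  have := hP.finite_latticePoints
  rw [isInitialComplex_iff] at hΔ
  obtain ⟨ω, hω⟩ := exists_weight_of_monomialOrder m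
  have hext : ∀ b : latticePoints (boundary P),
      ω (Set.inclusion (latticePoints_mono (boundary_subset P)) b) =
      (fun b => ω (Set.inclusion (latticePoints_mono (boundary_subset P)) b)) b := fun _ => rfl
  -- Monomials on a cell attain the weak duality bound, so none in the fibre is lighter. Both must
  -- therefore equal the standard monomial of the fibre, the unique lightest one.
  have hrel : ∀ {F : Set (Fin d → ℝ)} {σ : Set (latticePoints P)}
      {L : Module.Dual ℝ ((Fin d → ℝ) × ℝ)}, IsFacet P F → IsCellWitness F ω σ L →
      ∀ b c : latticePoints P →₀ ℕ, (∀ a ∈ b.support, a ∈ σ) → (∀ a ∈ c.support, a ∈ σ) →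
        gammaExp b = gammaExp c → b = c := by
    intro F σ L hF hL b c hb hc hbc
    have hbF : ∀ a ∈ b.support, toReal a.1 ∈ F := fun a ha => ((hL.mem_iff a).1 (hb a ha)).1
    obtain ⟨e, he, heb⟩ := exists_standard_of_notMem_interiorLattice m
      (hF.gammaExp_notMem_interiorLattice hP hbF)
    have key : ∀ c : latticePoints P →₀ ℕ, (∀ a ∈ c.support, a ∈ σ) → gammaExp c = gammaExp e →
        c = e := by
      intro c hc hce
      by_contra hne
      have h1 := hω e he c hce hne
      have h2 := hL.map_gammaExp_le (hF.support_subset hP heb hbF)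
      rw [← hce, hL.map_gammaExp_eq hc] at h2
      linarith
    rw [key b hb heb.symm, key c hc (hbc.symm.trans heb.symm)]
  refine ⟨fun b => ω (Set.inclusion (latticePoints_mono (boundary_subset P)) b),
    ⟨fun τ hτ => ?_, fun σ => ?_⟩⟩
  · obtain ⟨F, hF, σ, -, ⟨L, hL⟩, rfl⟩ := (mem_boundarySubdivision_iff hext).1 hτ
    exact affineIndependent_of_interpolating (exists_dual_interpolating (hrel hF hL))
  · rw [mem_boundarySubdivision_iff hext]
    constructor
    · intro hσ
      have hne : σ.Nonempty := (Δ.isRelLowerSet_faces hσ).1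
      have hstd := (hΔ σ hne).1 hσ
      obtain ⟨F, hF, hσF⟩ := exists_facet_of_notMem_nonstandard hP hne hstd
      refine ⟨F, hF, σ, hne, ?_, rfl⟩
      rcases exists_dual_or_weight_lt ω hσF with ⟨L, hLle, hLeq⟩ | ⟨n, b, hb, hw⟩
      -- The cell of $L$ may be larger than $\sigma$, but it has no integral relations, so its
      -- nonempty subset $\sigma$ is a cell as well.
      · have hL : IsCellWitness F ω {a | toReal a.1 ∈ F ∧ L (toReal a.1, 1) = ω a} L :=
          ⟨hLle, fun a => Iff.rfl⟩
        exact hL.exists_of_subset (exists_dual_interpolating (hrel hF hL))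
          fun a ha => ⟨hσF a ha, hLeq a ha⟩
      · refine absurd (hω _ (hstd n) b hb ?_) hw.not_gt
        rintro rfl
        exact lt_irrefl _ hw
    · rintro ⟨F, hF, σ', hne, ⟨L, hL⟩, hσ'⟩
      obtain rfl : (σ : Set (latticePoints P)) = σ' :=
        Set.image_injective.2 Subtype.val_injective hσ'
      rw [hΔ σ hne]
      intro n
      have hsupp : ∀ a ∈ (n • oneOn σ).support, a ∈ (σ : Set (latticePoints P)) := fun a ha =>
        mem_of_nsmul_oneOn_ne_zero (Finsupp.mem_support_iff.1 ha)
      obtain ⟨e, he, heσ⟩ := exists_standard_of_notMem_interiorLattice m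
        (hF.gammaExp_notMem_interiorLattice hP
          fun a ha => ((hL.mem_iff a).1 (hsupp a ha)).1)
      -- Both the standard monomial $e$ and the power of $x^\sigma$ are the unique lightest in this
      -- fibre, so they coincide.
      rcases eq_or_ne e (n • oneOn σ) with h | h
      · rwa [← h]
      · exact absurd (hω e he _ heσ.symm h.symm)
          (hL.weight_lt hP hF (hrel hF hL) hsupp heσ h).not_gt

/-- The value $0$ off the boundary is arbitrary: the relevant fibres lie in facets, so they only see
weights of boundary points. -/
theorem exists_extension (w : latticePoints (boundary P) → ℝ) :
    ∃ ω : latticePoints P → ℝ, ∀ b : latticePoints (boundary P),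
      ω (Set.inclusion (latticePoints_mono (boundary_subset P)) b) = w b := by
  classical
  exact ⟨fun a => if h : a.1 ∈ latticePoints (boundary P) then w ⟨a.1, h⟩ else 0,
    fun b => dif_pos b.2⟩

end Main

end BoundarySturmfels

end

open BoundarySturmfels

theorem mainTheorem1 {K : Type*} [Field K] {d : ℕ} (P : Set (Fin d → ℝ))
    (hP : IsLatticeDPolytope P) :
    toricBoundaryIdeal K P = toricIdeal K P ⊔ interiorMonomialIdeal K P ∧
    (∀ (Δ : PreAbstractSimplicialComplex (latticePoints P))
      (w : latticePoints (boundary P) → ℝ) (ω : latticePoints P → ℝ)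
      (m : MonomialOrder.{0, 0} (latticePoints P)),
      InducesTriangulation P w Δ → IsCompatibleExtension P w ω → IsWeightOrder ω m →
      (initialIdeal m (toricBoundaryIdeal K P)).radical = stanleyReisnerIdeal K Δ) ∧
    (∀ Δ : PreAbstractSimplicialComplex (latticePoints P),
      IsRegularBoundaryTriangulation P Δ ↔
        ∃ m : MonomialOrder.{0, 0} (latticePoints P),
          IsInitialComplex m (toricBoundaryIdeal K P) Δ) := by
  have := hP.finite_latticePoints
  refine ⟨toricBoundaryIdeal_eq_sup K P, ?_, fun Δ => ⟨?_, ?_⟩⟩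
  · intro Δ w ω m hΔ hω hm
    exact (isInitialComplex_of_inducesTriangulation hP hΔ hω.extends_weight hm).symm
  · rintro ⟨w, hΔ⟩
    obtain ⟨ω, hω⟩ := exists_extension w
    obtain ⟨m, hm⟩ := exists_isWeightOrder ω
    exact ⟨m, isInitialComplex_of_inducesTriangulation hP hΔ hω hm⟩
  · rintro ⟨m, hm⟩
    exact isRegularBoundaryTriangulation_of_isInitialComplex hP hm
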